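/- Let $\mathbb S=\mathbb R^2\times\mathbb R\times\mathbb R^\times$, $\mathbb R^\times=\mathbb R\setminus\{0\}$, be the shearlet group with left Haar measure $d\mu(b,s,a)=|a|^{-3}\,db\,ds\,da$, and put $\langle t\rangle=(1+|t|^2)^{1/2}$. For $(b,s,a)\in\mathbb S$ and $\psi:\mathbb R^2\to\mathbb C$ let $$\pi_{b,s,a}\psi(x)=|a|^{-3/4}\,\psi\big(A_a^{-1}N_s^{-1}(x-b)\big),\qquad N_s=\begin{pmatrix}1&-s\\0&1\end{pmatrix},\quad A_a=a\begin{pmatrix}1&0\\0&|a|^{-1/2}\end{pmatrix}.$$ Let $\mathcal S_0(\mathbb R^2)$ be the subspace of those Schwartz functions $\varphi$ on $\mathbb R^2$ with $\int x^m\varphi(x)\,dx=0$ for all $m\in\mathbb N^2$, with the topology induced by the Schwartz space, and let $\mathcal S_0'(\mathbb R^2)$ be its dual, with bilinear duality pairing $(\cdot,\cdot)$. Let $\mathcal S(\mathbb S)$ be the space of all $\Phi\in C^\infty(\mathbb S)$ for which the norms $$\sup_{((b_1,b_2),s,a)\in\mathbb S}\langle b_1\rangle^{k_1}\langle b_2\rangle^{k_2}\langle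 s\rangle^{l}\Big(|a|^m+\frac1{|a|^m}\Big)\big|\partial_a^\gamma\partial_s^\beta\partial_{b_2}^{\alpha_2}\partial_{b_1}^{\alpha_1}\Phi((b_1,b_2),s,a)\big|,\qquad k_1,k_2,l,m,\alpha_1,\alpha_2,\beta,\gamma\in\mathbb N,$$ are finite, with the topology defined by these norms, and let $\mathcal S'(\mathbb S)$ be its dual. For $\psi\in\mathcal S_0(\mathbb R^2)$ and $f\in\mathcal S_0'(\mathbb R^2)$ the distributional shearlet transform $\mathscr S_\psi f\in\mathcal S'(\mathbb S)$ is defined by transposition, $$(\mathscr S_\psi f,\Phi)=(f,\mathcal S^t_{\overline\psi}\Phi),\qquad \mathcal S^t_{\overline\psi}\Phi(x)=\int_{\mathbb S}\Phi(b,s,a)\,\pi_{b,s,a}\overline\psi(x)\,d\mu(b,s,a),\qquad\Phi\in\mathcal S(\mathbb S).$$ **Theorem.** Let $\psi\in\mathcal S_0(\mathbb R^2)$ and $f\in\mathcal S_0'(\mathbb R^2)$, and put $$S_\psi f(b,s,a)=\big(f,\overline{\pi_{b,s,a}\psi}\big),\qquad (b,s,a)\in\mathbb S .$$ Then $S_\psi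 f$ is smooth on $\mathbb S$ and of at most polynomial growth: there are constants $\nu_1,\nu_2,\nu_3,C>0$ with $$|S_\psi f(b,s,a)|\le C\,\langle b\rangle^{\nu_1}\langle s\rangle^{\nu_2}\Big(|a|^{\nu_3}+\frac1{|a|^{\nu_3}}\Big)\qquad\text{for all }(b,s,a)\in\mathbb S.$$ Moreover $\mathscr S_\psi f$ is well defined as an element of $\mathcal S'(\mathbb S)$ (in particular, for every $\Phi\in\mathcal S(\mathbb S)$, the integral defining $\mathcal S^t_{\overline\psi}\Phi(x)$ converges absolutely for every $x\in\mathbb R^2$ and $\mathcal S^t_{\overline\psi}\Phi\in\mathcal S_0(\mathbb R^2)$), and it is given by the function $S_\psi f$: for every $\Phi\in\mathcal S(\mathbb S)$ the integral on the right converges absolutely and $$(\mathscr S_\psi f,\Phi)=\int_{\mathbb S}S_\psi f(b,s,a)\,\Phi(b,s,a)\,d\mu(b,s,a).$$ -/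

import Mathlib

open MeasureTheory Set
open scoped SchwartzMap ContDiff

noncomputable section

namespace Shearlet

/-! ## Lizorkin test functions and Lizorkin distributions -/

theorem hasTemperateGrowth_monomial {d : ℕ} (m : Fin d → ℕ) :
    Function.HasTemperateGrowth
      (fun x : EuclideanSpace ℝ (Fin d) => ((∏ i, x i ^ m i : ℝ) : ℂ)) := by
  have h1 : ∀ i : Fin d, Function.HasTemperateGrowth
      (fun x : EuclideanSpace ℝ (Fin d) => ((x i : ℝ) : ℂ)) := fun i =>
    (Complex.ofRealCLM ∘L EuclideanSpace.proj (𝕜 := ℝ) i).hasTemperateGrowth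
  have h2 : ∀ (i : Fin d) (n : ℕ), Function.HasTemperateGrowth
      (fun x : EuclideanSpace ℝ (Fin d) => ((x i : ℝ) : ℂ) ^ n) := by
    intro i n
    induction n with
    | zero => simp
    | succ n ih =>
      simp only [pow_succ]
      exact ih.mul (h1 i)
  have h3 : ∀ s : Finset (Fin d), Function.HasTemperateGrowth
      (fun x : EuclideanSpace ℝ (Fin d) => ∏ i ∈ s, ((x i : ℝ) : ℂ) ^ m i) := by
    intro s
    induction s using Finset.induction_on with
    | empty => simp
    | insert i s hi ih =>
      simp only [Finset.prod_insert hi]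
      exact (h2 i (m i)).mul ih
  simpa using h3 Finset.univ

theorem integrable_monomial_mul {d : ℕ} (m : Fin d → ℕ)
    (φ : 𝓢(EuclideanSpace ℝ (Fin d), ℂ)) :
    Integrable (fun x => ((∏ i, x i ^ m i : ℝ) : ℂ) * φ x) := by
  have h := (SchwartzMap.smulLeftCLM ℂ
    (fun x : EuclideanSpace ℝ (Fin d) => ((∏ i, x i ^ m i : ℝ) : ℂ)) φ).integrable (μ := volume)
  refine h.congr (Filter.Eventually.of_forall fun x => ?_)
  simp only [SchwartzMap.smulLeftCLM_apply_apply (hasTemperateGrowth_monomial m), smul_eq_mul]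

/-- The Lizorkin space `𝒮₀(ℝᵈ)` of Schwartz functions all of whose moments vanish. As a subspace
of the Schwartz space it carries the relative topology. -/
def lizorkin (d : ℕ) : Submodule ℂ 𝓢(EuclideanSpace ℝ (Fin d), ℂ) where
  carrier := {φ | ∀ m : Fin d → ℕ, ∫ x, ((∏ i, x i ^ m i : ℝ) : ℂ) * φ x = 0}
  zero_mem' := by intro m; simp
  add_mem' := by
    intro φ χ hφ hχ m
    have h := integral_add (integrable_monomial_mul m φ) (integrable_monomial_mul m χ)
    rw [hφ m, hχ m] at h
    simpa [mul_add] using h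
  smul_mem' := by
    intro c φ hφ m
    have h := integral_const_mul (μ := volume) c (fun x => ((∏ i, x i ^ m i : ℝ) : ℂ) * φ x)
    rw [hφ m, mul_zero] at h
    simpa [mul_left_comm] using h

/-- The Euclidean plane `ℝ²`. -/
abbrev Plane : Type := EuclideanSpace ℝ (Fin 2)

/-- The space `𝒮₀(ℝ²)`. -/
abbrev S0 : Type := lizorkin 2

/-- The space `𝒮₀'(ℝ²)` of Lizorkin distributions. -/
abbrev S0Dual : Type := S0 →L[ℂ] ℂ

/-- The complex conjugate of a Schwartz function. -/
def conjSchwartz {d : ℕ} (φ : 𝓢(EuclideanSpace ℝ (Fin d), ℂ)) :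
    𝓢(EuclideanSpace ℝ (Fin d), ℂ) :=
  SchwartzMap.postcompCLM (𝕜 := ℝ) (Complex.conjCLE : ℂ →L[ℝ] ℂ) φ

theorem conjSchwartz_mem {d : ℕ} {φ : 𝓢(EuclideanSpace ℝ (Fin d), ℂ)} (hφ : φ ∈ lizorkin d) :
    conjSchwartz φ ∈ lizorkin d := by
  intro m
  have h := congrArg (starRingEnd ℂ) (hφ m)
  rw [← integral_conj, map_zero] at h
  simpa [conjSchwartz] using h

/-- The complex conjugate of an element of `𝒮₀(ℝ²)`. -/
def conjS0 (φ : S0) : S0 := ⟨conjSchwartz φ.1, conjSchwartz_mem φ.2⟩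

theorem conjS0_apply (φ : S0) (x : Plane) : (conjS0 φ).1 x = starRingEnd ℂ (φ.1 x) := rfl

/-! ## The shearlet group and its Haar measure -/

/-- The open subset `{(b, s, a) | a ≠ 0}` of `ℝ² × ℝ × ℝ`. -/
def shearletSet : Set (Plane × ℝ × ℝ) := {p | p.2.2 ≠ 0}

/-- The underlying space `𝕊 = ℝ² × ℝ × ℝˣ` of the shearlet group; points are `(b, s, a)`. -/
abbrev ShearletGroup : Type := shearletSet

/-- The translation parameter `b`. -/
def ShearletGroup.b (p : ShearletGroup) : Plane := p.1.1

/-- The shear parameter `s`. -/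
def ShearletGroup.s (p : ShearletGroup) : ℝ := p.1.2.1

/-- The dilation parameter `a`. -/
def ShearletGroup.a (p : ShearletGroup) : ℝ := p.1.2.2

/-- The left Haar measure `|a|⁻³ db ds da` on `𝕊`. -/
def haar : Measure ShearletGroup :=
  (Measure.comap Subtype.val (volume : Measure (Plane × ℝ × ℝ))).withDensity
    fun p : ShearletGroup => ENNReal.ofReal ((|p.a| ^ 3)⁻¹)

/-! ## The shearlet representation -/

/-- `N_s = [1, -s; 0, 1]`. -/
def shearMatrix (s : ℝ) : Matrix (Fin 2) (Fin 2) ℝ := !![1, -s; 0, 1]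

/-- `A_a = a [1, 0; 0, |a|^(-1/2)]`. -/
def dilationMatrix (a : ℝ) : Matrix (Fin 2) (Fin 2) ℝ := a • !![1, 0; 0, |a| ^ (-(1 / 2) : ℝ)]

theorem isUnit_det_shearMatrix (s : ℝ) : IsUnit (shearMatrix s).det := by
  simp [shearMatrix, Matrix.det_fin_two]

theorem isUnit_det_dilationMatrix {a : ℝ} (ha : a ≠ 0) : IsUnit (dilationMatrix a).det := by
  have h : |a| ^ (-(1 / 2) : ℝ) ≠ 0 := (Real.rpow_pos_of_pos (abs_pos.mpr ha) _).ne'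
  rw [isUnit_iff_ne_zero]
  simp only [dilationMatrix, Matrix.det_smul, Matrix.det_fin_two_of]
  simp only [mul_zero, sub_zero, one_mul, Fintype.card_fin]
  exact mul_ne_zero (pow_ne_zero 2 ha) h

/-- The matrix `A_a⁻¹ N_s⁻¹`. -/
def invMatrix (p : ShearletGroup) : Matrix (Fin 2) (Fin 2) ℝ :=
  (dilationMatrix p.a)⁻¹ * (shearMatrix p.s)⁻¹

theorem isUnit_det_invMatrix (p : ShearletGroup) : IsUnit (invMatrix p).det := by
  rw [invMatrix, Matrix.det_mul]
  exact (Matrix.isUnit_nonsing_inv_det _ (isUnit_det_dilationMatrix p.2)).mul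
    (Matrix.isUnit_nonsing_inv_det _ (isUnit_det_shearMatrix _))

/-- An invertible real matrix as a continuous linear automorphism of `ℝᵈ`. -/
def matrixEquiv {d : ℕ} (M : Matrix (Fin d) (Fin d) ℝ) (hM : IsUnit M.det) :
    EuclideanSpace ℝ (Fin d) ≃L[ℝ] EuclideanSpace ℝ (Fin d) :=
  ContinuousLinearEquiv.equivOfInverse
    (Matrix.toEuclideanCLM (n := Fin d) (𝕜 := ℝ) M)
    (Matrix.toEuclideanCLM (n := Fin d) (𝕜 := ℝ) M⁻¹)
    (fun x => by
      rw [← mul_apply_eq_comp, ← map_mul, Matrix.nonsing_inv_mul _ hM, map_one]; rfl)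
    (fun x => by
      rw [← mul_apply_eq_comp, ← map_mul, Matrix.mul_nonsing_inv _ hM, map_one]; rfl)

theorem integral_polynomial_mul_eq_zero {d : ℕ} {φ : 𝓢(EuclideanSpace ℝ (Fin d), ℂ)}
    (hφ : φ ∈ lizorkin d) (P : MvPolynomial (Fin d) ℝ) :
    ∫ x : EuclideanSpace ℝ (Fin d), ((MvPolynomial.eval (fun i => x i) P : ℝ) : ℂ) * φ x = 0 := by
  simp only [MvPolynomial.eval_eq', Complex.ofReal_sum, Finset.sum_mul]
  rw [integral_finsetSum]
  · refine Finset.sum_eq_zero fun n _ => ?_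
    simp only [Complex.ofReal_mul, mul_assoc]
    rw [integral_const_mul, hφ (fun i => n i), mul_zero]
  · intro n _
    simp only [Complex.ofReal_mul, mul_assoc]
    exact (integrable_monomial_mul (fun i => n i) φ).const_mul _

theorem comp_affine_mem {d : ℕ} {φ : 𝓢(EuclideanSpace ℝ (Fin d), ℂ)} (hφ : φ ∈ lizorkin d)
    (M : Matrix (Fin d) (Fin d) ℝ) (hM : IsUnit M.det) (b : EuclideanSpace ℝ (Fin d)) :
    SchwartzMap.compSubConstCLM ℂ b
      (SchwartzMap.compCLMOfContinuousLinearEquiv ℂ (matrixEquiv M hM) φ) ∈ lizorkin d := by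
  intro m
  let P : MvPolynomial (Fin d) ℝ := ∏ i,
    ((∑ j, MvPolynomial.C (M⁻¹ i j) * MvPolynomial.X j) + MvPolynomial.C (b i)) ^ m i
  have hP : ∀ z : EuclideanSpace ℝ (Fin d), MvPolynomial.eval (fun i => z i) P
      = ∏ i, ((matrixEquiv M hM).symm z + b) i ^ m i := by
    intro z
    have h : ∀ i, ((matrixEquiv M hM).symm z) i = ∑ j, M⁻¹ i j * z j := by
      intro i
      exact congrFun (Matrix.ofLp_toEuclideanCLM (𝕜 := ℝ) M⁻¹ z) i
    simp [P, h, map_prod]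
  let g : EuclideanSpace ℝ (Fin d) → ℂ :=
    fun z => ((MvPolynomial.eval (fun i => z i) P : ℝ) : ℂ) * φ z
  have hg : ∀ x : EuclideanSpace ℝ (Fin d), ((∏ i, x i ^ m i : ℝ) : ℂ) *
      (SchwartzMap.compSubConstCLM ℂ b
        (SchwartzMap.compCLMOfContinuousLinearEquiv ℂ (matrixEquiv M hM) φ)) x
      = g (matrixEquiv M hM (x - b)) := by
    intro x
    simp only [g, hP]
    simp
  simp only [hg]
  rw [integral_sub_right_eq_self (fun y => g (matrixEquiv M hM y)) b]
  have hdet : LinearMap.det ((matrixEquiv M hM : EuclideanSpace ℝ (Fin d) ≃ₗ[ℝ]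
      EuclideanSpace ℝ (Fin d)) : EuclideanSpace ℝ (Fin d) →ₗ[ℝ] EuclideanSpace ℝ (Fin d)) ≠ 0 :=
    (LinearEquiv.isUnit_det' _).ne_zero
  have hmap := Measure.map_linearMap_addHaar_eq_smul_addHaar
    (volume : Measure (EuclideanSpace ℝ (Fin d))) hdet
  have h := integral_map_equiv (μ := (volume : Measure (EuclideanSpace ℝ (Fin d))))
    (matrixEquiv M hM).toHomeomorph.toMeasurableEquiv g
  refine h.symm.trans ?_
  have hmap' : Measure.map (matrixEquiv M hM).toHomeomorph.toMeasurableEquiv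
      (volume : Measure (EuclideanSpace ℝ (Fin d))) = _ := hmap
  rw [hmap', integral_smul_measure, integral_polynomial_mul_eq_zero hφ P, smul_zero]

/-- The shearlet representation
`π_{b,s,a} ψ (x) = |a|^(-3/4) ψ (A_a⁻¹ N_s⁻¹ (x - b))` on `𝒮₀(ℝ²)`. -/
def shearletRep (p : ShearletGroup) (ψ : S0) : S0 :=
  ((|p.a| ^ (-(3 / 4) : ℝ) : ℝ) : ℂ) •
    ⟨SchwartzMap.compSubConstCLM ℂ p.b (SchwartzMap.compCLMOfContinuousLinearEquiv ℂ
        (matrixEquiv (invMatrix p) (isUnit_det_invMatrix p)) ψ.1),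
      comp_affine_mem ψ.2 (invMatrix p) (isUnit_det_invMatrix p) p.b⟩

theorem shearletRep_apply (p : ShearletGroup) (ψ : S0) (x : Plane) :
    (shearletRep p ψ).1 x = ((|p.a| ^ (-(3 / 4) : ℝ) : ℝ) : ℂ) *
      ψ.1 (WithLp.toLp 2 (((dilationMatrix p.a)⁻¹ * (shearMatrix p.s)⁻¹).mulVec
        (WithLp.ofLp (x - p.b)))) := rfl

/-! ## Smooth functions on `𝕊` and the test function space `𝒮(𝕊)` -/

/-- Extension by zero of a function on `𝕊` to `ℝ² × ℝ × ℝ`. It only serves to speak of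
derivatives at points of the open set `𝕊`. -/
def extendZero (F : ShearletGroup → ℂ) : Plane × ℝ × ℝ → ℂ := by
  classical
  exact fun p => if h : p ∈ shearletSet then F ⟨p, h⟩ else 0

/-- `F ∈ C^∞(𝕊)`. -/
def IsSmooth (F : ShearletGroup → ℂ) : Prop := ContDiffOn ℝ ∞ (extendZero F) shearletSet

/-- The derivative of `G` in the direction `v`. -/
def dirDeriv (v : Plane × ℝ × ℝ) (G : Plane × ℝ × ℝ → ℂ) : Plane × ℝ × ℝ → ℂ :=
  fun p => fderiv ℝ G p v

/-- The direction of `b₁`. -/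
def dirB1 : Plane × ℝ × ℝ := (EuclideanSpace.single 0 1, 0, 0)

/-- The direction of `b₂`. -/
def dirB2 : Plane × ℝ × ℝ := (EuclideanSpace.single 1 1, 0, 0)

/-- The direction of `s`. -/
def dirS : Plane × ℝ × ℝ := (0, 1, 0)

/-- The direction of `a`. -/
def dirA : Plane × ℝ × ℝ := (0, 0, 1)

/-- The eight indices of the norms on `𝒮(𝕊)`. -/
structure NormIndex where
  /-- power of `⟨b₁⟩` -/
  k₁ : ℕ
  /-- power of `⟨b₂⟩` -/
  k₂ : ℕ
  /-- power of `⟨s⟩` -/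
  l : ℕ
  /-- power of `|a|` and `1 / |a|` -/
  m : ℕ
  /-- order of the derivative in `b₁` -/
  α₁ : ℕ
  /-- order of the derivative in `b₂` -/
  α₂ : ℕ
  /-- order of the derivative in `s` -/
  β : ℕ
  /-- order of the derivative in `a` -/
  γ : ℕ

instance : Nonempty NormIndex := ⟨⟨0, 0, 0, 0, 0, 0, 0, 0⟩⟩

/-- `∂_a^γ ∂_s^β ∂_{b₂}^α₂ ∂_{b₁}^α₁ G`. -/
def mixedPartial (i : NormIndex) (G : Plane × ℝ × ℝ → ℂ) : Plane × ℝ × ℝ → ℂ :=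
  (dirDeriv dirA)^[i.γ] ((dirDeriv dirS)^[i.β]
    ((dirDeriv dirB2)^[i.α₂] ((dirDeriv dirB1)^[i.α₁] G)))

/-- `⟨t⟩ = (1 + |t|²)^(1/2)`. -/
def bracket {E : Type*} [Norm E] (t : E) : ℝ := Real.sqrt (1 + ‖t‖ ^ 2)

/-- The weight `⟨b₁⟩^k₁ ⟨b₂⟩^k₂ ⟨s⟩^l (|a|^m + 1 / |a|^m)`. -/
def weight (i : NormIndex) (p : ShearletGroup) : ℝ :=
  bracket (p.b 0) ^ i.k₁ * bracket (p.b 1) ^ i.k₂ * bracket p.s ^ i.l *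
    (|p.a| ^ i.m + 1 / |p.a| ^ i.m)

/-- The function whose supremum over `𝕊` is the norm with index `i`. -/
def normIntegrand (i : NormIndex) (F : ShearletGroup → ℂ) (p : ShearletGroup) : ℝ :=
  weight i p * ‖mixedPartial i (extendZero F) p.1‖

theorem weight_nonneg (i : NormIndex) (p : ShearletGroup) : 0 ≤ weight i p := by
  unfold weight bracket
  positivity

theorem normIntegrand_nonneg (i : NormIndex) (F : ShearletGroup → ℂ) (p : ShearletGroup) :
    0 ≤ normIntegrand i F p := mul_nonneg (weight_nonneg i p) (norm_nonneg _)

theorem isOpen_shearletSet : IsOpen shearletSet :=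
  isOpen_ne_fun (continuous_snd.comp continuous_snd) continuous_const

theorem dirDeriv_smooth (v : Plane × ℝ × ℝ) {G : Plane × ℝ × ℝ → ℂ}
    (hG : ContDiffOn ℝ ∞ G shearletSet) : ContDiffOn ℝ ∞ (dirDeriv v G) shearletSet :=
  (hG.fderiv_of_isOpen isOpen_shearletSet (m := ∞) (by simp)).clm_apply contDiffOn_const

theorem dirDeriv_iterate (v : Plane × ℝ × ℝ) (n : ℕ) : ∀ (G G₁ G₂ : Plane × ℝ × ℝ → ℂ) (c : ℂ),
    ContDiffOn ℝ ∞ G₁ shearletSet → ContDiffOn ℝ ∞ G₂ shearletSet →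
    EqOn G (G₁ + c • G₂) shearletSet →
    ContDiffOn ℝ ∞ ((dirDeriv v)^[n] G₁) shearletSet ∧
    ContDiffOn ℝ ∞ ((dirDeriv v)^[n] G₂) shearletSet ∧
    EqOn ((dirDeriv v)^[n] G) ((dirDeriv v)^[n] G₁ + c • (dirDeriv v)^[n] G₂) shearletSet := by
  induction n with
  | zero => exact fun G G₁ G₂ c h₁ h₂ h => ⟨h₁, h₂, h⟩
  | succ n ih =>
    intro G G₁ G₂ c h₁ h₂ h
    simp only [Function.iterate_succ_apply]
    refine ih _ _ _ c (dirDeriv_smooth v h₁) (dirDeriv_smooth v h₂) fun p hp => ?_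
    have hU := isOpen_shearletSet.mem_nhds hp
    have d₁ : DifferentiableAt ℝ G₁ p := (h₁.contDiffAt hU).differentiableAt (by simp)
    have d₂ : DifferentiableAt ℝ G₂ p := (h₂.contDiffAt hU).differentiableAt (by simp)
    have e : G =ᶠ[nhds p] (G₁ + c • G₂) := Filter.mem_of_superset hU h
    simp only [dirDeriv, e.fderiv_eq, Pi.add_apply, Pi.smul_apply]
    rw [fderiv_add d₁ (d₂.const_smul c), fderiv_const_smul d₂]
    rfl

theorem mixedPartial_eqOn (i : NormIndex) (G G₁ G₂ : Plane × ℝ × ℝ → ℂ) (c : ℂ)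
    (h₁ : ContDiffOn ℝ ∞ G₁ shearletSet) (h₂ : ContDiffOn ℝ ∞ G₂ shearletSet)
    (h : EqOn G (G₁ + c • G₂) shearletSet) :
    EqOn (mixedPartial i G) (mixedPartial i G₁ + c • mixedPartial i G₂) shearletSet := by
  obtain ⟨a₁, a₂, a⟩ := dirDeriv_iterate dirB1 i.α₁ G G₁ G₂ c h₁ h₂ h
  obtain ⟨b₁, b₂, b⟩ := dirDeriv_iterate dirB2 i.α₂ _ _ _ c a₁ a₂ a
  obtain ⟨c₁, c₂, e⟩ := dirDeriv_iterate dirS i.β _ _ _ c b₁ b₂ b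
  exact (dirDeriv_iterate dirA i.γ _ _ _ c c₁ c₂ e).2.2

theorem extendZero_add_smul (F₁ F₂ : ShearletGroup → ℂ) (c : ℂ) :
    extendZero (F₁ + c • F₂) = extendZero F₁ + c • extendZero F₂ := by
  funext p
  by_cases hp : p ∈ shearletSet <;> simp [extendZero, hp]

theorem IsSmooth.add_smul {F₁ F₂ : ShearletGroup → ℂ} (h₁ : IsSmooth F₁) (h₂ : IsSmooth F₂)
    (c : ℂ) : IsSmooth (F₁ + c • F₂) := by
  unfold IsSmooth
  rw [extendZero_add_smul]
  exact ContDiffOn.add h₁ (ContDiffOn.const_smul c h₂)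

theorem isSmooth_zero : IsSmooth 0 := by
  have h : extendZero 0 = fun _ => (0 : ℂ) := by
    funext p
    simp [extendZero]
  unfold IsSmooth
  rw [h]
  exact contDiffOn_const

theorem normIntegrand_add_le (i : NormIndex) {F₁ F₂ : ShearletGroup → ℂ} (h₁ : IsSmooth F₁)
    (h₂ : IsSmooth F₂) (p : ShearletGroup) :
    normIntegrand i (F₁ + F₂) p ≤ normIntegrand i F₁ p + normIntegrand i F₂ p := by
  have e := mixedPartial_eqOn i (extendZero (F₁ + F₂)) _ _ 1 h₁ h₂
    (fun q _ => by have := extendZero_add_smul F₁ F₂ 1; rw [one_smul] at this; rw [this]) p.2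
  unfold normIntegrand
  rw [e, ← mul_add]
  refine mul_le_mul_of_nonneg_left ?_ (weight_nonneg i p)
  simpa using norm_add_le (mixedPartial i (extendZero F₁) p.1) (mixedPartial i (extendZero F₂) p.1)

theorem normIntegrand_smul (i : NormIndex) (c : ℂ) {F : ShearletGroup → ℂ} (h : IsSmooth F)
    (p : ShearletGroup) : normIntegrand i (c • F) p = ‖c‖ * normIntegrand i F p := by
  have e := mixedPartial_eqOn i (extendZero (c • F)) _ _ (c - 1) h h
    (fun q _ => by
      rw [← extendZero_add_smul F F (c - 1), sub_smul, one_smul, add_sub_cancel]) p.2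
  have e' : mixedPartial i (extendZero (c • F)) p.1 = c * mixedPartial i (extendZero F) p.1 := by
    rw [e]
    simp only [Pi.add_apply, Pi.smul_apply, smul_eq_mul]
    ring
  unfold normIntegrand
  rw [e', norm_mul]
  ring

theorem normIntegrand_zero (i : NormIndex) (p : ShearletGroup) : normIntegrand i 0 p = 0 := by
  have h := normIntegrand_smul i 0 isSmooth_zero p
  simpa using h

/-- The space `𝒮(𝕊)` as a space of functions: smooth functions all of whose norms are finite. -/
def shearletSubmodule : Submodule ℂ (ShearletGroup → ℂ) where
  carrier := {Φ | IsSmooth Φ ∧ ∀ i, BddAbove (range (normIntegrand i Φ))}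
  zero_mem' := ⟨isSmooth_zero, fun i => ⟨0, by
    rintro _ ⟨p, rfl⟩
    exact (normIntegrand_zero i p).le⟩⟩
  add_mem' := by
    rintro Φ Ψ ⟨hΦ, bΦ⟩ ⟨hΨ, bΨ⟩
    refine ⟨by simpa using hΦ.add_smul hΨ 1, fun i => ?_⟩
    obtain ⟨A, hA⟩ := bΦ i
    obtain ⟨B, hB⟩ := bΨ i
    refine ⟨A + B, ?_⟩
    rintro _ ⟨p, rfl⟩
    exact (normIntegrand_add_le i hΦ hΨ p).trans (add_le_add (hA ⟨p, rfl⟩) (hB ⟨p, rfl⟩))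
  smul_mem' := by
    rintro c Φ ⟨hΦ, bΦ⟩
    refine ⟨by simpa using isSmooth_zero.add_smul hΦ c, fun i => ?_⟩
    obtain ⟨A, hA⟩ := bΦ i
    refine ⟨‖c‖ * A, ?_⟩
    rintro _ ⟨p, rfl⟩
    rw [normIntegrand_smul i c hΦ p]
    exact mul_le_mul_of_nonneg_left (hA ⟨p, rfl⟩) (norm_nonneg c)

/-- The test function space `𝒮(𝕊)`. It is a type of its own, so that its topology is the one
given by the norms and not the topology of pointwise convergence. -/
def TestSpace : Type := shearletSubmodule

instance : AddCommGroup TestSpace := inferInstanceAs (AddCommGroup shearletSubmodule)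

instance : Module ℂ TestSpace := inferInstanceAs (Module ℂ shearletSubmodule)

instance : CoeFun TestSpace fun _ => ShearletGroup → ℂ := ⟨fun Φ => Subtype.val Φ⟩

instance : Nonempty ShearletGroup := ⟨⟨(0, 0, 1), one_ne_zero⟩⟩

/-- The norm on `𝒮(𝕊)` with index `i`, i.e.
`sup ⟨b₁⟩^k₁ ⟨b₂⟩^k₂ ⟨s⟩^l (|a|^m + 1 / |a|^m) |∂_a^γ ∂_s^β ∂_{b₂}^α₂ ∂_{b₁}^α₁ Φ(b, s, a)|`. -/
def testNorm (i : NormIndex) : Seminorm ℂ TestSpace :=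
  Seminorm.ofSMulLE (fun Φ => ⨆ p : ShearletGroup, normIntegrand i Φ p)
    (by
      have h : (fun p => normIntegrand i ((0 : TestSpace) : ShearletGroup → ℂ) p)
          = fun _ => (0 : ℝ) := by
        funext p
        exact normIntegrand_zero i p
      rw [h, ciSup_const])
    (fun Φ Ψ => ciSup_le fun p => (normIntegrand_add_le i Φ.2.1 Ψ.2.1 p).trans
      (add_le_add (le_ciSup (Φ.2.2 i) p) (le_ciSup (Ψ.2.2 i) p)))
    (fun c Φ => ciSup_le fun p => (normIntegrand_smul i c Φ.2.1 p).le.trans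
      (mul_le_mul_of_nonneg_left (le_ciSup (Φ.2.2 i) p) (norm_nonneg c)))

/-- The family of norms of `𝒮(𝕊)`. -/
def testNormFamily : SeminormFamily ℂ TestSpace NormIndex := testNorm

/-- `𝒮(𝕊)` carries the locally convex topology defined by its norms. -/
instance : TopologicalSpace TestSpace := testNormFamily.moduleFilterBasis.topology'

theorem testSpace_withSeminorms : WithSeminorms testNormFamily := ⟨rfl⟩

/-- The dual space `𝒮'(𝕊)`. -/
abbrev TestSpaceDual : Type := TestSpace →L[ℂ] ℂ

/-! ## Functions of polynomial growth as elements of `𝒮'(𝕊)` -/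

/-- `F` is of at most polynomial growth on `𝕊`. -/
def HasPolynomialGrowth (F : ShearletGroup → ℂ) : Prop :=
  ∃ ν₁ ν₂ ν₃ C : ℝ, 0 < ν₁ ∧ 0 < ν₂ ∧ 0 < ν₃ ∧ 0 < C ∧ ∀ p : ShearletGroup,
    ‖F p‖ ≤ C * bracket p.b ^ ν₁ * bracket p.s ^ ν₂ * (|p.a| ^ ν₃ + 1 / |p.a| ^ ν₃)

/-- The functional `T ∈ 𝒮'(𝕊)` is given by the function `F`: for every `Φ ∈ 𝒮(𝕊)` the integral
`∫ F Φ dμ` over `𝕊` converges absolutely and equals `(T, Φ)`. -/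
def IsGivenBy (T : TestSpaceDual) (F : ShearletGroup → ℂ) : Prop :=
  ∀ Φ : TestSpace, Integrable (fun p => F p * Φ p) haar ∧ T Φ = ∫ p, F p * Φ p ∂haar

/-! ## The shearlet transform of Lizorkin distributions -/

/-- The shearlet synthesis operator `𝒮ᵗ_ψ Φ (x) = ∫ Φ(b, s, a) π_{b,s,a} ψ (x) dμ(b, s, a)`. -/
def synthesis (ψ : S0) (Φ : TestSpace) (x : Plane) : ℂ :=
  ∫ p, Φ p * (shearletRep p ψ).1 x ∂haar

/-- `T ∈ 𝒮'(𝕊)` is the distributional shearlet transform of `f ∈ 𝒮₀'(ℝ²)` with respect to `ψ`,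
defined by transposition as `(T, Φ) = (f, 𝒮ᵗ_{conj ψ} Φ)`. This includes that the integral defining
`𝒮ᵗ_{conj ψ} Φ` converges absolutely at every point and that `𝒮ᵗ_{conj ψ} Φ` is
in `𝒮₀(ℝ²)`. -/
def IsShearletTransform (ψ : S0) (f : S0Dual) (T : TestSpaceDual) : Prop :=
  ∀ Φ : TestSpace,
    (∀ x : Plane, Integrable (fun p => Φ p * (shearletRep p (conjS0 ψ)).1 x) haar) ∧
    ∃ φ : S0, (∀ x : Plane, φ.1 x = synthesis (conjS0 ψ) Φ x) ∧ T Φ = f φ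

/-- There is at most one distributional shearlet transform of `f` with respect to `ψ`. -/
theorem IsShearletTransform.unique {ψ : S0} {f : S0Dual} {T T' : TestSpaceDual}
    (h : IsShearletTransform ψ f T) (h' : IsShearletTransform ψ f T') : T = T' := by
  refine ContinuousLinearMap.ext fun Φ => ?_
  obtain ⟨-, φ, hφ, e⟩ := h Φ
  obtain ⟨-, φ', hφ', e'⟩ := h' Φ
  have : φ = φ' := Subtype.ext (SchwartzMap.ext fun x => (hφ x).trans (hφ' x).symm)
  rw [e, e', this]

/-- The function `S_ψ f (b, s, a) = (f, conj (π_{b,s,a} ψ))` on `𝕊`, where the pairing of `𝒮₀'(ℝ²)`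
with `𝒮₀(ℝ²)` is bilinear. -/
def shearletFunction (ψ : S0) (f : S0Dual) (p : ShearletGroup) : ℂ :=
  f (conjS0 (shearletRep p ψ))

end Shearlet

end

/-! By Hahn–Banach `f` extends to a continuous functional `G` on the whole Schwartz space, and since
conjugation commutes with the representation, the shearlet function is `p ↦ G (π_p ψ̄)`. Everything
then follows from two facts about the orbit map `p ↦ π_p ψ̄` into the Schwartz space.

Regularity: up to a scalar, the orbit consists of functions `ψ̄ (M (x - b))` with `(b, M)` depending
smoothly on `p`. The derivative of such a function in `(b, M)` is a finite sum of smooth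
coefficients times functions of the same form, built from `∂_i ψ̄` and `x_j ∂_i ψ̄`. The mean value
formula turns this pointwise identity into continuity and differentiability in every Schwartz
seminorm; hence `contDiffOn_functional_affineComp` by induction on the order.

Growth: each Schwartz seminorm of `π_p ψ̄` is bounded by a power of `size p`
(`exists_seminorm_shearletRep_le`), while test functions decay faster than every power of `size` and
`size ^ (-5)` is Haar integrable. This gives the polynomial growth and the continuity of `Φ ↦ ∫ S_ψ
f Φ dμ`. It also makes `Φ p • π_p ψ̄` a dominated family, so its integral is a Schwartz function and
continuous functionals pass under the integral sign (`IsDominated.functional`). Applied to the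
moments this puts the synthesis in `𝒮₀`; applied to `G` it is the asserted formula. -/

noncomputable section

namespace Shearlet

open scoped Topology

/-! ### Integrals of dominated families of Schwartz functions -/

section Integral

variable {E F P : Type*} [NormedAddCommGroup E] [NormedSpace ℝ E]
  [NormedAddCommGroup F] [NormedSpace ℝ F] [MeasurableSpace P] {μ : Measure P}

/-- A family of Schwartz functions is dominated if each Schwartz seminorm is bounded by an
integrable function and all derivatives depend measurably on the parameter. -/
structure IsDominated (μ : Measure P) (h : P → 𝓢(E, F)) : Prop where
  meas : ∀ n x, AEStronglyMeasurable (fun p => iteratedFDeriv ℝ n (h p) x) μ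
  bound : ∀ k n, ∃ B : P → ℝ, Integrable B μ ∧ ∀ᵐ p ∂μ, SchwartzMap.seminorm ℝ k n (h p) ≤ B p

theorem IsDominated.integrable {h : P → 𝓢(E, F)} (H : IsDominated μ h) (n : ℕ) (x : E) :
    Integrable (fun p => iteratedFDeriv ℝ n (h p) x) μ := by
  obtain ⟨B, hB, hle⟩ := H.bound 0 n
  exact hB.mono' (H.meas n x)
    (hle.mono fun p hp => (SchwartzMap.norm_iteratedFDeriv_le_seminorm ℝ (h p) n x).trans hp)

theorem IsDominated.integrable_apply {h : P → 𝓢(E, F)} (H : IsDominated μ h) (x : E) :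
    Integrable (fun p => h p x) μ := by
  have := (continuousMultilinearCurryFin0 ℝ E F).toContinuousLinearEquiv.toContinuousLinearMap
    |>.integrable_comp (H.integrable 0 x)
  simpa using this

variable [CompleteSpace F]

/-- Differentiation under the integral sign, one order at a time. The seminorm `(0, n + 1)` bounds
the next derivative uniformly in `x`, so its integrable bound dominates on the whole space. -/
theorem IsDominated.hasFTaylorSeriesUpTo {h : P → 𝓢(E, F)} (H : IsDominated μ h) :
    HasFTaylorSeriesUpTo ∞ (fun x => ∫ p, h p x ∂μ)
      (fun x n => ∫ p, iteratedFDeriv ℝ n (h p) x ∂μ) := by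
  have key : ∀ (n : ℕ) (x : E), HasFDerivAt (fun y => ∫ p, iteratedFDeriv ℝ n (h p) y ∂μ)
      (∫ p, iteratedFDeriv ℝ (n + 1) (h p) x ∂μ).curryLeft x := by
    intro n x
    let L := continuousMultilinearCurryLeftEquiv ℝ (fun _ : Fin (n + 1) => E) F
    obtain ⟨B, hB, hle⟩ := H.bound 0 (n + 1)
    have e : (∫ p, iteratedFDeriv ℝ (n + 1) (h p) x ∂μ).curryLeft
        = ∫ p, (iteratedFDeriv ℝ (n + 1) (h p) x).curryLeft ∂μ := by
      have := ContinuousLinearEquiv.integral_comp_comm (𝕜 := ℝ) (μ := μ)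
        (E := E [×(n + 1)]→L[ℝ] F) (F := E →L[ℝ] (E [×n]→L[ℝ] F)) L.toContinuousLinearEquiv
        (fun p => iteratedFDeriv ℝ (n + 1) (h p) x)
      exact this.symm
    rw [e]
    refine hasFDerivAt_integral_of_dominated_of_fderiv_le (𝕜 := ℝ) (bound := B) Filter.univ_mem
      (Filter.Eventually.of_forall fun y => H.meas n y) (H.integrable n x)
      (F' := fun y p => (iteratedFDeriv ℝ (n + 1) (h p) y).curryLeft)
      (L.continuous.comp_aestronglyMeasurable (H.meas (n + 1) x)) ?_ hB ?_
    · filter_upwards [hle] with p hp y _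
      rw [ContinuousMultilinearMap.curryLeft_norm]
      exact (SchwartzMap.norm_iteratedFDeriv_le_seminorm ℝ (h p) (n + 1) y).trans hp
    · refine Filter.Eventually.of_forall fun p y _ => ?_
      have hd := ((h p).smooth (n + 1 : ℕ)).contDiffAt (x := y) |>.differentiableAt_iteratedFDeriv
        (m := n) (by exact_mod_cast Nat.lt_succ_self n)
      exact hd.hasFDerivAt
  refine ⟨fun x => ?_, fun n _ x => key n x, fun n _ =>
    continuous_iff_continuousAt.2 fun x => (key n x).continuousAt⟩
  have := (continuousMultilinearCurryFin0 ℝ E F).toContinuousLinearEquiv.toContinuousLinearMap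
    |>.integral_comp_comm (H.integrable 0 x)
  exact this.symm.trans (by simp)

/-- The integral of a dominated family of Schwartz functions is a Schwartz function. -/
def IsDominated.integral {h : P → 𝓢(E, F)} (H : IsDominated μ h) : 𝓢(E, F) where
  toFun x := ∫ p, h p x ∂μ
  smooth' := H.hasFTaylorSeriesUpTo.contDiff
  decay' k n := by
    obtain ⟨B, hB, hle⟩ := H.bound k n
    refine ⟨∫ p, B p ∂μ, fun x => ?_⟩
    rw [← H.hasFTaylorSeriesUpTo.eq_iteratedFDeriv (m := n) (by exact_mod_cast le_top) x,
      ← Real.norm_of_nonneg (by positivity : 0 ≤ ‖x‖ ^ k), ← norm_smul, ← integral_smul]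
    refine norm_integral_le_of_norm_le hB (hle.mono fun p hp => ?_)
    rw [norm_smul, Real.norm_of_nonneg (by positivity : 0 ≤ ‖x‖ ^ k)]
    exact (SchwartzMap.le_seminorm ℝ k n (h p) x).trans hp

theorem IsDominated.integral_apply {h : P → 𝓢(E, F)} (H : IsDominated μ h) (x : E) :
    H.integral x = ∫ p, h p x ∂μ := rfl

theorem IsDominated.iteratedFDeriv_integral {h : P → 𝓢(E, F)} (H : IsDominated μ h) (n : ℕ)
    (x : E) : iteratedFDeriv ℝ n H.integral x = ∫ p, iteratedFDeriv ℝ n (h p) x ∂μ :=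
  (H.hasFTaylorSeriesUpTo.eq_iteratedFDeriv (m := n) (by exact_mod_cast le_top) x).symm

theorem IsDominated.seminorm_integral_le {h : P → 𝓢(E, F)} (H : IsDominated μ h) {k n : ℕ}
    {B : P → ℝ} (hB : Integrable B μ)
    (hle : ∀ᵐ p ∂μ, SchwartzMap.seminorm ℝ k n (h p) ≤ B p) :
    SchwartzMap.seminorm ℝ k n H.integral ≤ ∫ p, B p ∂μ := by
  refine SchwartzMap.seminorm_le_bound ℝ k n _ (integral_nonneg_of_ae
    (hle.mono fun p hp => (apply_nonneg _ _).trans hp)) fun x => ?_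
  rw [H.iteratedFDeriv_integral, ← Real.norm_of_nonneg (by positivity : 0 ≤ ‖x‖ ^ k), ← norm_smul,
    ← integral_smul]
  refine norm_integral_le_of_norm_le hB (hle.mono fun p hp => ?_)
  rw [norm_smul, Real.norm_of_nonneg (by positivity : 0 ≤ ‖x‖ ^ k)]
  exact (SchwartzMap.le_seminorm ℝ k n (h p) x).trans hp

end Integral

/-! ### Continuous functionals commute with Schwartz-valued integrals -/

section Functional

open scoped BoundedContinuousFunction

variable {E F P : Type*} [NormedAddCommGroup E] [NormedSpace ℝ E]
  [NormedAddCommGroup F] [NormedSpace ℝ F]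

/-- Bounded continuous functions with values in a normed space. -/
abbrev BoundedMap (E W : Type*) [TopologicalSpace E] [NormedAddCommGroup W] : Type _ := E →ᵇ W

/-- The weighted derivative `x ↦ ‖x‖ ^ k • D ^ n φ x` as a bounded continuous function. -/
def weightedDeriv (k n : ℕ) : 𝓢(E, F) →L[ℝ] BoundedMap E (E [×n]→L[ℝ] F) :=
  SchwartzMap.mkCLMtoNormedSpace
    (fun φ => BoundedContinuousFunction.ofNormedAddCommGroup
      (fun x => ‖x‖ ^ k • iteratedFDeriv ℝ n φ x)
      ((continuous_norm.pow k).smul ((φ.smooth n).continuous_iteratedFDeriv le_rfl))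
      (SchwartzMap.seminorm ℝ k n φ) (fun x => by
        rw [norm_smul, Real.norm_of_nonneg (by positivity : 0 ≤ ‖x‖ ^ k)]
        exact SchwartzMap.le_seminorm ℝ k n φ x))
    (fun φ χ => by
      ext1 x
      have : iteratedFDeriv ℝ n (⇑φ + ⇑χ) x = _ := iteratedFDeriv_add_apply
        ((φ.smooth n).contDiffAt) ((χ.smooth n).contDiffAt)
      simp [this])
    (fun a φ => by
      ext1 x
      have : iteratedFDeriv ℝ n (a • ⇑φ) x = _ := iteratedFDeriv_const_smul_apply
        ((φ.smooth n).contDiffAt)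
      simp [this, smul_comm (‖x‖ ^ k) a])
    ⟨{(k, n)}, 1, zero_le_one, fun φ => by
      rw [Finset.sup_singleton, one_mul]
      exact BoundedContinuousFunction.norm_ofNormedAddCommGroup_le _ (apply_nonneg _ _) _⟩

theorem weightedDeriv_apply (k n : ℕ) (φ : 𝓢(E, F)) (x : E) :
    weightedDeriv k n φ x = ‖x‖ ^ k • iteratedFDeriv ℝ n φ x := rfl

theorem norm_weightedDeriv_le (k n : ℕ) (φ : 𝓢(E, F)) :
    ‖weightedDeriv k n φ‖ ≤ SchwartzMap.seminorm ℝ k n φ := by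
  refine (BoundedContinuousFunction.norm_le (apply_nonneg _ _)).2 fun x => ?_
  rw [weightedDeriv_apply, norm_smul, Real.norm_of_nonneg (by positivity : 0 ≤ ‖x‖ ^ k)]
  exact SchwartzMap.le_seminorm ℝ k n φ x

theorem seminorm_le_norm_weightedDeriv (k n : ℕ) (φ : 𝓢(E, F)) :
    SchwartzMap.seminorm ℝ k n φ ≤ ‖weightedDeriv k n φ‖ := by
  refine SchwartzMap.seminorm_le_bound ℝ k n φ (norm_nonneg _) fun x => ?_
  have h := (weightedDeriv k n φ).norm_coe_le_norm x
  rwa [weightedDeriv_apply, norm_smul, Real.norm_of_nonneg (by positivity : 0 ≤ ‖x‖ ^ k)] at h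

/-- A linear functional bounded by the norm of a linear map factors through it continuously. -/
theorem exists_factor_of_norm_le {V B : Type*} [AddCommGroup V] [Module ℝ V]
    [NormedAddCommGroup B] [NormedSpace ℝ B] (J : V →ₗ[ℝ] B) (f : V →ₗ[ℝ] ℝ) (C : ℝ)
    (h : ∀ v, ‖f v‖ ≤ C * ‖J v‖) : ∃ g : B →L[ℝ] ℝ, ∀ v, f v = g (J v) := by
  -- The section `σ` is only algebraic; it is `f ∘ σ` that is bounded on the range, and Hahn–Banach
  -- extends it.
  obtain ⟨σ, hσ⟩ := J.rangeRestrict.exists_rightInverse_of_surjective J.range_rangeRestrict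
  have hσ' : ∀ y : LinearMap.range J, J (σ y) = y := fun y =>
    congrArg Subtype.val (LinearMap.congr_fun hσ y)
  obtain ⟨g, hg, -⟩ := exists_extension_norm_eq (LinearMap.range J)
    ((f ∘ₗ σ).mkContinuous C fun y => by simpa [hσ' y] using h (σ y))
  refine ⟨g, fun v => ?_⟩
  have e := hg ⟨J v, v, rfl⟩
  -- The vector `v - σ (J v)` lies in the kernel of `J`, where the bound forces `f` to vanish; so `f
  -- ∘ σ ∘ J = f`.
  have z := h (v - σ ⟨J v, v, rfl⟩)
  rw [map_sub, map_sub, hσ', sub_self, norm_zero, mul_zero, norm_le_zero_iff, sub_eq_zero] at z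
  rw [z]
  exact e.symm

/-- Continuity bounds `G` by finitely many seminorms, each of which is the sup norm of a weighted
derivative. Thus `G` factors through a finite product of Banach spaces, where Bochner integration is
available. -/
theorem exists_factor_weightedDeriv (G : 𝓢(E, F) →L[ℝ] ℝ) :
    ∃ (s : Finset (ℕ × ℕ)) (g : (∀ i : s, BoundedMap E (E [×i.1.2]→L[ℝ] F)) →L[ℝ] ℝ),
      ∀ φ, G φ = g (fun i => weightedDeriv i.1.1 i.1.2 φ) := by
  obtain ⟨s, C, -, hC⟩ := Seminorm.bound_of_continuous (schwartz_withSeminorms ℝ E F)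
    G.toSeminorm G.continuous.norm
  refine ⟨s, exists_factor_of_norm_le
    (LinearMap.pi fun i : s => (weightedDeriv i.1.1 i.1.2 : 𝓢(E, F) →L[ℝ] _).toLinearMap)
    G.toLinearMap C fun φ => (hC φ).trans ?_⟩
  refine mul_le_mul_of_nonneg_left ?_ C.2
  refine Seminorm.finset_sup_apply_le (norm_nonneg _) fun i hi => ?_
  refine (seminorm_le_norm_weightedDeriv i.1 i.2 φ).trans ?_
  exact norm_le_pi_norm (fun i : s => weightedDeriv (F := F) (E := E) i.1.1 i.1.2 φ) ⟨i, hi⟩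

variable [CompleteSpace F] [MeasurableSpace P] [TopologicalSpace P] [OpensMeasurableSpace P]
  [SecondCountableTopology P] {μ : Measure P}

theorem IsDominated.functional_real {h : P → 𝓢(E, F)} (H : IsDominated μ h) (hc : Continuous h)
    (G : 𝓢(E, F) →L[ℝ] ℝ) :
    Integrable (fun p => G (h p)) μ ∧ G H.integral = ∫ p, G (h p) ∂μ := by
  obtain ⟨s, g, hg⟩ := exists_factor_weightedDeriv G
  -- Spaces of bounded continuous functions need not be separable; strong measurability comes from
  -- the continuity of `h` on a second countable space.
  have hi : ∀ i : s, Integrable (fun p => weightedDeriv i.1.1 i.1.2 (h p)) μ := by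
    intro i
    obtain ⟨B, hB, hle⟩ := H.bound i.1.1 i.1.2
    exact hB.mono' (((weightedDeriv _ _).continuous.comp hc).aestronglyMeasurable)
      (hle.mono fun p hp => (norm_weightedDeriv_le _ _ _).trans hp)
  have hI : Integrable (fun p => (fun i : s => weightedDeriv (E := E) (F := F) i.1.1 i.1.2 (h p)))
      μ := Integrable.of_eval hi
  have e : (fun i : s => weightedDeriv (E := E) (F := F) i.1.1 i.1.2 H.integral)
      = ∫ p, (fun i : s => weightedDeriv (E := E) (F := F) i.1.1 i.1.2 (h p)) ∂μ := by
    funext i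
    rw [eval_integral hi]
    ext1 x
    have := (BoundedContinuousFunction.evalCLM ℝ x).integral_comp_comm (hi i)
    refine Eq.trans ?_ this
    simp only [BoundedContinuousFunction.evalCLM_apply, weightedDeriv_apply]
    rw [integral_smul, H.iteratedFDeriv_integral]
  simp only [hg]
  exact ⟨g.integrable_comp hI, by rw [e, g.integral_comp_comm hI]⟩

/-- The factorization concerns real functionals, so real and imaginary parts are treated separately.
-/
theorem IsDominated.functional {h : P → 𝓢(E, F)} (H : IsDominated μ h) (hc : Continuous h)
    (G : 𝓢(E, F) →L[ℝ] ℂ) :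
    Integrable (fun p => G (h p)) μ ∧ G H.integral = ∫ p, G (h p) ∂μ := by
  obtain ⟨i₁, e₁⟩ := H.functional_real hc (Complex.reCLM ∘L G)
  obtain ⟨i₂, e₂⟩ := H.functional_real hc (Complex.imCLM ∘L G)
  have hI : Integrable (fun p => G (h p)) μ := by
    have := i₁.ofReal (𝕜 := ℂ) |>.add (i₂.ofReal (𝕜 := ℂ) |>.mul_const Complex.I)
    refine this.congr (Filter.Eventually.of_forall fun p => ?_)
    exact Complex.re_add_im (G (h p))
  refine ⟨hI, Complex.ext ?_ ?_⟩
  · exact e₁.trans (Complex.reCLM.integral_comp_comm hI)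
  · exact e₂.trans (Complex.imCLM.integral_comp_comm hI)

end Functional

/-! ## Composition of Schwartz functions with affine maps -/

/-- Parameters `(b, M)` of the affine maps `x ↦ M (x - b)` of the plane. -/
abbrev AffineParam : Type := Plane × (Plane →L[ℝ] Plane)

/-- The parameters of the invertible affine maps. -/
def affineSet : Set AffineParam := {θ | θ.2.IsInvertible}

theorem isOpen_affineSet : IsOpen affineSet :=
  (ContinuousLinearEquiv.isOpen (𝕜 := ℝ) (E := Plane) (F := Plane)).preimage continuous_snd

open Classical in
/-- The Schwartz function `x ↦ ψ (M (x - b))`, and zero if `M` is not invertible. -/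
def affineComp (θ : AffineParam) (ψ : 𝓢(Plane, ℂ)) : 𝓢(Plane, ℂ) :=
  if h : θ.2.IsInvertible then
    SchwartzMap.compSubConstCLM ℂ θ.1 (SchwartzMap.compCLMOfContinuousLinearEquiv ℂ h.choose ψ)
  else 0

theorem affineComp_apply {θ : AffineParam} (hθ : θ ∈ affineSet) (ψ : 𝓢(Plane, ℂ)) (x : Plane) :
    affineComp θ ψ x = ψ (θ.2 (x - θ.1)) := by
  have h : θ.2.IsInvertible := hθ
  rw [affineComp, dif_pos h]
  exact congrArg ψ (congrArg (fun L : Plane →L[ℝ] Plane => L (x - θ.1)) h.choose_spec)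

theorem iteratedFDeriv_affineComp {θ : AffineParam} (hθ : θ ∈ affineSet) (ψ : 𝓢(Plane, ℂ)) (n : ℕ)
    (x : Plane) : iteratedFDeriv ℝ n (affineComp θ ψ) x
      = (iteratedFDeriv ℝ n ψ (θ.2 (x - θ.1))).compContinuousLinearMap fun _ => θ.2 := by
  have h : (affineComp θ ψ : Plane → ℂ) = fun x => (ψ ∘ θ.2) (x - θ.1) :=
    funext fun x => affineComp_apply hθ ψ x
  rw [h, iteratedFDeriv_comp_sub]
  exact θ.2.iteratedFDeriv_comp_right (ψ.smooth n) _ le_rfl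

/-- A bound for the Schwartz seminorms of `affineComp θ ψ`. -/
def affineBound (k n : ℕ) (ψ : 𝓢(Plane, ℂ)) (θ : AffineParam) : ℝ :=
  ‖θ.2‖ ^ n * (2 ^ k * (‖θ.2.inverse‖ ^ k * SchwartzMap.seminorm ℝ k n ψ
    + ‖θ.1‖ ^ k * SchwartzMap.seminorm ℝ 0 n ψ))

theorem affineBound_nonneg (k n : ℕ) (ψ : 𝓢(Plane, ℂ)) (θ : AffineParam) :
    0 ≤ affineBound k n ψ θ := by
  unfold affineBound
  positivity

/-- Put `y = M (x - b)`. The chain rule costs `‖M‖ ^ n`, and `x = M⁻¹ y + b` lets the weight `‖x‖ ^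
k` be split into a part absorbed by the decay of `ψ` at `y` and a part in `b`. -/
theorem seminorm_affineComp_le {θ : AffineParam} (hθ : θ ∈ affineSet) (ψ : 𝓢(Plane, ℂ))
    (k n : ℕ) : SchwartzMap.seminorm ℝ k n (affineComp θ ψ) ≤ affineBound k n ψ θ := by
  refine SchwartzMap.seminorm_le_bound ℝ k n _ (affineBound_nonneg k n ψ θ) fun x => ?_
  rw [iteratedFDeriv_affineComp hθ]
  set y := θ.2 (x - θ.1) with hy
  have hx : ‖x‖ ≤ ‖θ.2.inverse‖ * ‖y‖ + ‖θ.1‖ := by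
    have e : x = θ.2.inverse y + θ.1 := by
      rw [hy, ContinuousLinearMap.IsInvertible.inverse_apply_self hθ, sub_add_cancel]
    calc ‖x‖ = ‖θ.2.inverse y + θ.1‖ := congrArg _ e
      _ ≤ _ := (norm_add_le _ _).trans (add_le_add (θ.2.inverse.le_opNorm y) le_rfl)
  have hk : ‖x‖ ^ k ≤ 2 ^ k * (‖θ.2.inverse‖ ^ k * ‖y‖ ^ k + ‖θ.1‖ ^ k) := by
    refine (pow_le_pow_left₀ (norm_nonneg x) hx k).trans ?_
    refine (add_pow_le (by positivity) (by positivity) k).trans ?_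
    rw [mul_pow]
    gcongr
    · norm_num
    · omega
  have hd : ‖(iteratedFDeriv ℝ n ψ y).compContinuousLinearMap fun _ => θ.2‖
      ≤ ‖iteratedFDeriv ℝ n ψ y‖ * ‖θ.2‖ ^ n := by
    refine (ContinuousMultilinearMap.norm_compContinuousLinearMap_le _ _).trans_eq ?_
    simp
  have h1 := SchwartzMap.le_seminorm ℝ k n ψ y
  have h2 := SchwartzMap.norm_iteratedFDeriv_le_seminorm ℝ ψ n y
  calc _ ≤ (2 ^ k * (‖θ.2.inverse‖ ^ k * ‖y‖ ^ k + ‖θ.1‖ ^ k))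
        * (‖iteratedFDeriv ℝ n ψ y‖ * ‖θ.2‖ ^ n) := by gcongr
    _ = ‖θ.2‖ ^ n * (2 ^ k * (‖θ.2.inverse‖ ^ k * (‖y‖ ^ k * ‖iteratedFDeriv ℝ n ψ y‖)
        + ‖θ.1‖ ^ k * ‖iteratedFDeriv ℝ n ψ y‖)) := by ring
    _ ≤ _ := by unfold affineBound; gcongr

theorem continuousOn_inverse :
    ContinuousOn (fun θ : AffineParam => θ.2.inverse) affineSet := fun _ hθ =>
  ((ContinuousLinearMap.IsInvertible.contDiffAt_map_inverse (n := 0) hθ).continuousAt.comp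
    continuous_snd.continuousAt).continuousWithinAt

theorem continuousOn_affineBound (k n : ℕ) (ψ : 𝓢(Plane, ℂ)) :
    ContinuousOn (affineBound k n ψ) affineSet := by
  unfold affineBound
  have := continuousOn_inverse
  fun_prop

theorem continuousOn_iteratedFDeriv_affineComp (ψ : 𝓢(Plane, ℂ)) (n : ℕ) (x : Plane) :
    ContinuousOn (fun θ => iteratedFDeriv ℝ n (affineComp θ ψ) x) affineSet := by
  refine ContinuousOn.congr (f := fun θ : AffineParam =>
    ContinuousMultilinearMap.compContinuousLinearMapContinuousMultilinear ℝ
      (fun _ : Fin n => Plane) (fun _ => Plane) ℂ (fun _ => θ.2)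
      (iteratedFDeriv ℝ n ψ (θ.2 (x - θ.1)))) ?_ fun θ hθ => iteratedFDeriv_affineComp hθ ψ n x
  have h1 : Continuous fun θ : AffineParam => iteratedFDeriv ℝ n ψ (θ.2 (x - θ.1)) :=
    ((ψ.smooth n).continuous_iteratedFDeriv le_rfl).comp
      (continuous_snd.clm_apply (continuous_const.sub continuous_fst))
  have h2 : Continuous fun θ : AffineParam =>
      ContinuousMultilinearMap.compContinuousLinearMapContinuousMultilinear ℝ
      (fun _ : Fin n => Plane) (fun _ => Plane) ℂ (fun _ => θ.2) :=
    (ContinuousMultilinearMap.cont _).comp (continuous_pi fun _ => continuous_snd)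
  exact (h2.clm_apply h1).continuousOn

/-! ### Differentiation in the affine parameters -/

/-- The operators `∂_i` and `x_j ∂_i` on Schwartz functions. -/
def affineOp : Option (Fin 2) × Fin 2 → 𝓢(Plane, ℂ) → 𝓢(Plane, ℂ)
  | (none, i), ψ => LineDeriv.lineDerivOp (EuclideanSpace.single i (1 : ℝ)) ψ
  | (some j, i), ψ => SchwartzMap.smulLeftCLM ℂ (fun x : Plane => x j)
      (LineDeriv.lineDerivOp (EuclideanSpace.single i (1 : ℝ)) ψ)

/-- The coefficients of the operators `affineOp` in the derivative of `affineComp θ ψ`. -/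
def affineCoeff : Option (Fin 2) × Fin 2 → AffineParam → (AffineParam →L[ℝ] ℝ)
  | (none, i), θ => -(EuclideanSpace.proj (𝕜 := ℝ) i ∘L θ.2 ∘L
      ContinuousLinearMap.fst ℝ Plane (Plane →L[ℝ] Plane))
  | (some j, i), θ => EuclideanSpace.proj (𝕜 := ℝ) i ∘L
      ContinuousLinearMap.apply ℝ Plane (θ.2.inverse (EuclideanSpace.single j (1 : ℝ))) ∘L
      ContinuousLinearMap.snd ℝ Plane (Plane →L[ℝ] Plane)

theorem contDiffOn_affineCoeff (κ : Option (Fin 2) × Fin 2) :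
    ContDiffOn ℝ ∞ (affineCoeff κ) affineSet := by
  obtain ⟨_ | j, i⟩ := κ
  · exact (contDiff_const.clm_comp (contDiff_snd.clm_comp contDiff_const)).neg.contDiffOn
  · intro θ hθ
    have h : ContDiffAt ℝ ∞ (fun θ : AffineParam => θ.2.inverse) θ :=
      (ContinuousLinearMap.IsInvertible.contDiffAt_map_inverse hθ).comp θ contDiff_snd.contDiffAt
    have h' : ContDiffAt ℝ ∞ (fun θ : AffineParam => ContinuousLinearMap.apply ℝ Plane
        (θ.2.inverse (EuclideanSpace.single j (1 : ℝ))) (E := Plane)) θ :=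
      (ContinuousLinearMap.contDiff _).contDiffAt.comp θ (h.clm_apply contDiffAt_const)
    exact (contDiffAt_const.clm_comp (h'.clm_comp contDiffAt_const)).contDiffWithinAt

/-- The derivative of `affineComp · ψ` at `θ` in the direction `v`. -/
def affineDeriv (θ v : AffineParam) (ψ : 𝓢(Plane, ℂ)) : 𝓢(Plane, ℂ) :=
  ∑ κ, affineCoeff κ θ v • affineComp θ (affineOp κ ψ)

theorem plane_eq_sum (y : Plane) : y = ∑ j, y j • EuclideanSpace.single j (1 : ℝ) := by
  ext i
  fin_cases i <;> simp

/-- The right side is the chain rule. Its factor `x - b` is unbounded, but equals `M⁻¹ y` with `y =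
M (x - b)`; expanding `y` in coordinates turns it into the operators `x_j ∂_i` evaluated at `y`,
with coefficients independent of `x`. -/
theorem affineDeriv_apply {θ : AffineParam} (hθ : θ ∈ affineSet) (v : AffineParam)
    (ψ : 𝓢(Plane, ℂ)) (x : Plane) : affineDeriv θ v ψ x
      = fderiv ℝ ψ (θ.2 (x - θ.1)) (v.2 (x - θ.1) - θ.2 v.1) := by
  set y := θ.2 (x - θ.1) with hy
  have e : x - θ.1 = θ.2.inverse y := by
    rw [hy, ContinuousLinearMap.IsInvertible.inverse_apply_self hθ]
  have hd : ∀ w : Plane, fderiv ℝ ψ y w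
      = ∑ i, (w i : ℂ) * fderiv ℝ ψ y (EuclideanSpace.single i 1) := by
    intro w
    conv_lhs => rw [plane_eq_sum w]
    simp
  have hs : ∀ j : Fin 2, Function.HasTemperateGrowth (fun x : Plane => x j) := fun j =>
    (EuclideanSpace.proj (𝕜 := ℝ) j : Plane →L[ℝ] ℝ).hasTemperateGrowth
  have hv : ∀ i, (v.2 (θ.2.inverse y)) i
      = ∑ j, y j * (v.2 (θ.2.inverse (EuclideanSpace.single j 1))) i := by
    intro i
    conv_lhs => rw [plane_eq_sum y]
    simp
  rw [e, map_sub, hd, hd, affineDeriv, _root_.sum_apply]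
  simp only [_root_.smul_apply, affineComp_apply hθ, ← hy, hv, Fintype.sum_prod_type,
    Fintype.sum_option, affineOp, affineCoeff, Fin.sum_univ_two,
    SchwartzMap.smulLeftCLM_apply_apply (hs _), SchwartzMap.lineDerivOp_apply_eq_fderiv]
  simp
  ring

theorem hasDerivAt_affineComp {θ v : AffineParam} {u : ℝ} (hθ : θ + u • v ∈ affineSet)
    (ψ : 𝓢(Plane, ℂ)) (x : Plane) :
    HasDerivAt (fun t : ℝ => affineComp (θ + t • v) ψ x) (affineDeriv (θ + u • v) v ψ x) u := by
  have hl : HasDerivAt (fun t : ℝ => θ + t • v) v u := by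
    simpa using ((hasDerivAt_id u).smul_const v).const_add θ
  have h1 : HasDerivAt (fun t : ℝ => (θ + t • v).1) v.1 u :=
    (ContinuousLinearMap.fst ℝ Plane (Plane →L[ℝ] Plane)).hasFDerivAt.comp_hasDerivAt u hl
  have h2 : HasDerivAt (fun t : ℝ => (θ + t • v).2) v.2 u :=
    (ContinuousLinearMap.snd ℝ Plane (Plane →L[ℝ] Plane)).hasFDerivAt.comp_hasDerivAt u hl
  have h3 := h2.clm_apply (h1.const_sub x)
  have h4 := (ψ.differentiableAt.hasFDerivAt).comp_hasDerivAt u h3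
  have ev : ∀ᶠ t in 𝓝 u, θ + t • v ∈ affineSet :=
    hl.continuousAt.eventually (isOpen_affineSet.mem_nhds hθ)
  rw [affineDeriv_apply hθ]
  refine HasDerivAt.congr_of_eventuallyEq ?_ (ev.mono fun t ht => affineComp_apply ht ψ x)
  convert! h4 using 2
  rw [map_neg, sub_eq_add_neg]

/-- The `n`-th derivative at a point as a linear map on Schwartz functions. -/
def derivAt (n : ℕ) (x : Plane) : 𝓢(Plane, ℂ) →L[ℝ] (Plane [×n]→L[ℝ] ℂ) :=
  BoundedContinuousFunction.evalCLM ℝ x ∘L weightedDeriv 0 n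

theorem derivAt_apply (n : ℕ) (x : Plane) (φ : 𝓢(Plane, ℂ)) :
    derivAt n x φ = iteratedFDeriv ℝ n φ x := by
  simp [derivAt, weightedDeriv_apply]

theorem seminorm_sum_le {ι : Type*} (k n : ℕ) (s : Finset ι) (f : ι → 𝓢(Plane, ℂ)) :
    SchwartzMap.seminorm ℝ k n (∑ i ∈ s, f i) ≤ ∑ i ∈ s, SchwartzMap.seminorm ℝ k n (f i) :=
  Finset.le_sum_of_subadditive _ (map_zero _).le (map_add_le_add _) s f

theorem seminorm_affineDeriv_le {θ : AffineParam} (hθ : θ ∈ affineSet) (v : AffineParam)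
    (ψ : 𝓢(Plane, ℂ)) (k n : ℕ) : SchwartzMap.seminorm ℝ k n (affineDeriv θ v ψ)
      ≤ ∑ κ, |affineCoeff κ θ v| * affineBound k n (affineOp κ ψ) θ := by
  refine (seminorm_sum_le _ _ _ _).trans (Finset.sum_le_sum fun κ _ => ?_)
  rw [map_smul_eq_mul, Real.norm_eq_abs]
  exact mul_le_mul_of_nonneg_left (seminorm_affineComp_le hθ _ k n) (abs_nonneg _)

theorem continuousOn_affineCoeff (κ : Option (Fin 2) × Fin 2) :
    ContinuousOn (affineCoeff κ) affineSet := (contDiffOn_affineCoeff κ).continuousOn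

theorem continuousOn_norm_clm_sub {V X : Type*} [TopologicalSpace X] [NormedAddCommGroup V]
    [NormedSpace ℝ V] {s : Set X} {f : X → V →L[ℝ] ℝ} (h : ContinuousOn f s) (L : V →L[ℝ] ℝ) :
    ContinuousOn (fun x => ‖f x - L‖) s := (h.sub continuousOn_const).norm

theorem continuousOn_norm_clm {V X : Type*} [TopologicalSpace X] [NormedAddCommGroup V]
    [NormedSpace ℝ V] {s : Set X} {f : X → V →L[ℝ] ℝ} (h : ContinuousOn f s) :
    ContinuousOn (fun x => ‖f x‖) s := h.norm

/-- Everything is continuous along the compact segment. The fixed function `w` allows two uses: `w =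
0` for continuity, and `w` the derivative at the base point for differentiability. -/
theorem isDominated_affineDeriv {θ v : AffineParam}
    (hU : ∀ u ∈ Icc (0 : ℝ) 1, θ + u • v ∈ affineSet) (ψ w : 𝓢(Plane, ℂ)) :
    IsDominated (volume.restrict (Icc (0 : ℝ) 1)) fun u => affineDeriv (θ + u • v) v ψ - w := by
  have hl : ContinuousOn (fun u : ℝ => θ + u • v) (Icc 0 1) := by fun_prop
  have hc : ∀ κ, ContinuousOn (fun u : ℝ => affineCoeff κ (θ + u • v) v) (Icc 0 1) := fun κ =>
    ((continuousOn_affineCoeff κ).comp hl hU).clm_apply continuousOn_const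
  refine ⟨fun n x => ContinuousOn.aestronglyMeasurable ?_ measurableSet_Icc, fun k n => ?_⟩
  · have h : ContinuousOn (fun u : ℝ => (∑ κ, affineCoeff κ (θ + u • v) v •
        iteratedFDeriv ℝ n (affineComp (θ + u • v) (affineOp κ ψ)) x)
          - iteratedFDeriv ℝ n w x) (Icc 0 1) :=
      (continuousOn_finsetSum _ fun κ _ => (hc κ).smul
        ((continuousOn_iteratedFDeriv_affineComp _ n x).comp hl hU)).sub continuousOn_const
    refine h.congr fun u _ => ?_
    simp only [← derivAt_apply, affineDeriv, map_sub, map_sum, map_smul]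
  · refine ⟨fun u => (∑ κ, |affineCoeff κ (θ + u • v) v| *
      affineBound k n (affineOp κ ψ) (θ + u • v)) + SchwartzMap.seminorm ℝ k n w, ?_, ?_⟩
    · refine ContinuousOn.integrableOn_compact isCompact_Icc ?_
      exact (continuousOn_finsetSum _ fun κ _ => (hc κ).abs.mul
        ((continuousOn_affineBound k n _).comp hl hU)).add continuousOn_const
    · refine (ae_restrict_iff' measurableSet_Icc).2 (Filter.Eventually.of_forall fun u hu => ?_)
      exact (map_sub_le_add _ _ _).trans
        (add_le_add (seminorm_affineDeriv_le (hU u hu) v ψ k n) le_rfl)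

/-- The mean value inequality for `affineComp` in the Schwartz seminorms. -/
theorem seminorm_affineComp_sub_le {θ v : AffineParam}
    (hU : ∀ u ∈ Icc (0 : ℝ) 1, θ + u • v ∈ affineSet) (ψ w : 𝓢(Plane, ℂ)) (k n : ℕ) (K : ℝ)
    (hK : ∀ u ∈ Icc (0 : ℝ) 1,
      SchwartzMap.seminorm ℝ k n (affineDeriv (θ + u • v) v ψ - w) ≤ K) :
    SchwartzMap.seminorm ℝ k n (affineComp (θ + v) ψ - affineComp θ ψ - w) ≤ K := by
  have H := isDominated_affineDeriv hU ψ w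
  -- Fundamental theorem of calculus at each `x`: the increment is the integral of the derivative
  -- along the segment, and `w` is constant on an interval of length one.
  have e : affineComp (θ + v) ψ - affineComp θ ψ - w = H.integral := by
    ext x
    have H0 := isDominated_affineDeriv hU ψ 0
    have hi : IntervalIntegrable (fun u => affineDeriv (θ + u • v) v ψ x) volume 0 1 := by
      rw [intervalIntegrable_iff_integrableOn_Icc_of_le zero_le_one]
      have := H0.integrable_apply x
      simp only [sub_zero] at this
      exact this
    have ftc := intervalIntegral.integral_eq_sub_of_hasDerivAt
      (f := fun t : ℝ => affineComp (θ + t • v) ψ x) (a := 0) (b := 1)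
      (fun u hu => hasDerivAt_affineComp (hU u (by simpa using hu)) ψ x) hi
    rw [intervalIntegral.integral_of_le zero_le_one, ← integral_Icc_eq_integral_Ioc] at ftc
    rw [H.integral_apply]
    have h1 : Integrable (fun u => affineDeriv (θ + u • v) v ψ x)
        (volume.restrict (Icc (0 : ℝ) 1)) := by simpa using H0.integrable_apply x
    simp only [_root_.sub_apply]
    rw [integral_sub h1 (integrable_const _), ftc]
    have e1 : θ + (1 : ℝ) • v = θ + v := by rw [one_smul]
    have e0 : θ + (0 : ℝ) • v = θ := by
      have := zero_smul ℝ v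
      rw [this, add_zero]
    rw [e1, e0]
    simp
  rw [e]
  refine (H.seminorm_integral_le (integrable_const K)
    ((ae_restrict_iff' measurableSet_Icc).2 (Filter.Eventually.of_forall hK))).trans_eq ?_
  simp

theorem segment_mem_of_ball {θ θ' : AffineParam} {r : ℝ}
    (hθ' : θ' ∈ Metric.ball θ r) : ∀ u ∈ Icc (0 : ℝ) 1, θ + u • (θ' - θ) ∈ Metric.ball θ r := by
  have h0 : 0 < r := Metric.pos_of_mem_ball hθ'
  intro u hu
  exact (convex_ball θ r).add_smul_sub_mem (Metric.mem_ball_self h0) hθ' hu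

/-- A local Lipschitz estimate: `N` bounds the seminorm of the derivative per unit direction, and is
at most `N θ + 1` near `θ` by continuity. -/
theorem tendsto_seminorm_affineComp {θ : AffineParam} (hθ : θ ∈ affineSet) (ψ : 𝓢(Plane, ℂ))
    (k n : ℕ) : Filter.Tendsto
      (fun θ' => SchwartzMap.seminorm ℝ k n (affineComp θ' ψ - affineComp θ ψ)) (𝓝 θ) (𝓝 0) := by
  let N : AffineParam → ℝ := fun θ' => ∑ κ, ‖affineCoeff κ θ'‖ * affineBound k n (affineOp κ ψ) θ'
  have hN : ContinuousAt N θ := by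
    refine ContinuousOn.continuousAt ?_ (isOpen_affineSet.mem_nhds hθ)
    exact continuousOn_finsetSum _ fun κ _ => ContinuousOn.mul
      (continuousOn_norm_clm (continuousOn_affineCoeff κ)) (continuousOn_affineBound k n (affineOp κ ψ))
  obtain ⟨r, hr, hball⟩ := Metric.eventually_nhds_iff_ball.1
    ((hN.eventually (gt_mem_nhds (lt_add_one (N θ)))).and (isOpen_affineSet.mem_nhds hθ))
  have hz : Filter.Tendsto (fun θ' => ‖θ' - θ‖ * (N θ + 1)) (𝓝 θ) (𝓝 0) := by
    have : Continuous fun θ' : AffineParam => ‖θ' - θ‖ * (N θ + 1) := by fun_prop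
    simpa using this.tendsto θ
  refine squeeze_zero' (Filter.Eventually.of_forall fun _ => apply_nonneg _ _) ?_ hz
  filter_upwards [Metric.ball_mem_nhds θ hr] with θ' hθ'
  have hs := segment_mem_of_ball hθ'
  have := seminorm_affineComp_sub_le (fun u hu => (hball _ (hs u hu)).2) ψ 0 k n
    (‖θ' - θ‖ * (N θ + 1)) fun u hu => by
      obtain ⟨h1, h2⟩ := hball _ (hs u hu)
      rw [sub_zero]
      refine (seminorm_affineDeriv_le h2 _ ψ k n).trans ?_
      refine le_trans ?_ (mul_le_mul_of_nonneg_left h1.le (norm_nonneg _))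
      rw [Finset.mul_sum]
      refine Finset.sum_le_sum fun κ _ => ?_
      rw [← mul_assoc, mul_comm ‖θ' - θ‖]
      exact mul_le_mul_of_nonneg_right ((affineCoeff κ _).le_opNorm _)
        (affineBound_nonneg _ _ _ _)
  simpa using this

theorem continuousAt_affineComp {θ : AffineParam} (hθ : θ ∈ affineSet) (ψ : 𝓢(Plane, ℂ)) :
    ContinuousAt (fun θ' => affineComp θ' ψ) θ := by
  refine ((schwartz_withSeminorms ℝ Plane ℂ).tendsto_nhds _ _).2 fun i ε hε => ?_
  exact (tendsto_seminorm_affineComp hθ ψ i.1 i.2).eventually (gt_mem_nhds hε)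

/-- The mean value inequality with the derivative at `θ` subtracted. Here `N` bounds the oscillation
of the derivative, which tends to zero because the coefficients and, by the preceding continuity,
the compositions converge. -/
theorem seminorm_affineComp_sub_affineDeriv_le {θ : AffineParam} (hθ : θ ∈ affineSet)
    (ψ : 𝓢(Plane, ℂ)) (k n : ℕ) {ε : ℝ} (hε : 0 < ε) :
    ∀ᶠ θ' in 𝓝 θ, SchwartzMap.seminorm ℝ k n
      (affineComp θ' ψ - affineComp θ ψ - affineDeriv θ (θ' - θ) ψ) ≤ ε * ‖θ' - θ‖ := by
  let N : AffineParam → ℝ := fun θ' => ∑ κ, (‖affineCoeff κ θ' - affineCoeff κ θ‖ *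
    affineBound k n (affineOp κ ψ) θ' + ‖affineCoeff κ θ‖ * SchwartzMap.seminorm ℝ k n
      (affineComp θ' (affineOp κ ψ) - affineComp θ (affineOp κ ψ)))
  have hN : Filter.Tendsto N (𝓝 θ) (𝓝 0) := by
    have hU := isOpen_affineSet.mem_nhds hθ
    rw [show (0 : ℝ) = ∑ κ, (0 * affineBound k n (affineOp κ ψ) θ +
      ‖affineCoeff κ θ‖ * 0) by simp]
    refine tendsto_finsetSum _ fun κ _ => Filter.Tendsto.add (Filter.Tendsto.mul ?_ ?_)
      ((tendsto_seminorm_affineComp hθ _ k n).const_mul _)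
    · have := (continuousOn_norm_clm_sub (continuousOn_affineCoeff κ)
        (affineCoeff κ θ)).continuousAt hU
      simpa only [ContinuousAt, sub_self, norm_zero] using this
    · exact (continuousOn_affineBound k n _).continuousAt hU
  obtain ⟨r, hr, hball⟩ := Metric.eventually_nhds_iff_ball.1
    ((hN.eventually (gt_mem_nhds hε)).and (isOpen_affineSet.mem_nhds hθ))
  filter_upwards [Metric.ball_mem_nhds θ hr] with θ' hθ'
  have hs := segment_mem_of_ball hθ'
  have := seminorm_affineComp_sub_le (fun u hu => (hball _ (hs u hu)).2) ψ
    (affineDeriv θ (θ' - θ) ψ) k n (ε * ‖θ' - θ‖) fun u hu => by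
      obtain ⟨h1, h2⟩ := hball _ (hs u hu)
      set ϑ := θ + u • (θ' - θ)
      refine le_trans ?_ (mul_le_mul_of_nonneg_right h1.le (norm_nonneg _))
      -- Difference of products: first the coefficient varies, then the Schwartz function.
      have e : affineDeriv ϑ (θ' - θ) ψ - affineDeriv θ (θ' - θ) ψ
          = ∑ κ, ((affineCoeff κ ϑ - affineCoeff κ θ) (θ' - θ) • affineComp ϑ (affineOp κ ψ)
            + affineCoeff κ θ (θ' - θ) •
              (affineComp ϑ (affineOp κ ψ) - affineComp θ (affineOp κ ψ))) := by
        rw [affineDeriv, affineDeriv, ← Finset.sum_sub_distrib]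
        refine Finset.sum_congr rfl fun κ _ => ?_
        rw [_root_.sub_apply, sub_smul, smul_sub]
        abel
      rw [e, Finset.sum_mul]
      refine (seminorm_sum_le _ _ _ _).trans (Finset.sum_le_sum fun κ _ => ?_)
      refine (map_add_le_add _ _ _).trans ?_
      rw [map_smul_eq_mul, map_smul_eq_mul, add_mul, mul_right_comm, mul_right_comm _ _ ‖θ' - θ‖]
      have n1 := apply_nonneg (SchwartzMap.seminorm ℝ k n)
        (affineComp ϑ (affineOp κ ψ) - affineComp θ (affineOp κ ψ))
      refine add_le_add (mul_le_mul ((affineCoeff κ ϑ - affineCoeff κ θ).le_opNorm _)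
        (seminorm_affineComp_le h2 _ k n) (apply_nonneg _ _) (by positivity))
        (mul_le_mul_of_nonneg_right ((affineCoeff κ θ).le_opNorm _) n1)
  simpa using this

/-- Only finitely many seminorms control `G`, so the first-order estimates in each of them hold
simultaneously near `θ`. -/
theorem hasFDerivAt_functional_affineComp (G : 𝓢(Plane, ℂ) →L[ℝ] ℂ) {θ : AffineParam}
    (hθ : θ ∈ affineSet) (ψ : 𝓢(Plane, ℂ)) :
    HasFDerivAt (fun θ' => G (affineComp θ' ψ))
      (∑ κ, (affineCoeff κ θ).smulRight (G (affineComp θ (affineOp κ ψ)))) θ := by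
  obtain ⟨s, C, hC0, hC⟩ := Seminorm.bound_of_continuous (schwartz_withSeminorms ℝ Plane ℂ)
    ((normSeminorm ℝ ℂ).comp G.toLinearMap) G.continuous.norm
  have hC1 : (0 : ℝ) < C := NNReal.coe_pos.2 (pos_iff_ne_zero.2 hC0)
  refine HasFDerivAt.of_isLittleO (Asymptotics.isLittleO_iff.2 fun ε hε => ?_)
  have ev : ∀ᶠ θ' in 𝓝 θ, ∀ i ∈ s, SchwartzMap.seminorm ℝ i.1 i.2
      (affineComp θ' ψ - affineComp θ ψ - affineDeriv θ (θ' - θ) ψ) ≤ ε / C * ‖θ' - θ‖ :=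
    (Filter.eventually_all_finset s).2 fun i _ =>
      seminorm_affineComp_sub_affineDeriv_le hθ ψ i.1 i.2 (div_pos hε hC1)
  filter_upwards [ev] with θ' h
  have e : G (affineComp θ' ψ) - G (affineComp θ ψ)
      - (∑ κ, (affineCoeff κ θ).smulRight (G (affineComp θ (affineOp κ ψ)))) (θ' - θ)
      = G (affineComp θ' ψ - affineComp θ ψ - affineDeriv θ (θ' - θ) ψ) := by
    rw [map_sub G, map_sub G, affineDeriv, map_sum G]
    simp only [_root_.sum_apply, ContinuousLinearMap.smulRight_apply, map_smul]
  rw [e]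
  refine (hC _).trans ?_
  have h1 : (s.sup (schwartzSeminormFamily ℝ Plane ℂ))
      (affineComp θ' ψ - affineComp θ ψ - affineDeriv θ (θ' - θ) ψ) ≤ ε / C * ‖θ' - θ‖ :=
    Seminorm.finset_sup_apply_le (by positivity) h
  refine (mul_le_mul_of_nonneg_left h1 hC1.le).trans_eq ?_
  field_simp

/-- The derivative is made of smooth coefficients and functions of the same type with `ψ` replaced
by `affineOp κ ψ`; hence the induction is over all `ψ` at once. -/
theorem contDiffOn_functional_affineComp (G : 𝓢(Plane, ℂ) →L[ℝ] ℂ) (ψ : 𝓢(Plane, ℂ)) :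
    ContDiffOn ℝ ∞ (fun θ => G (affineComp θ ψ)) affineSet := by
  refine contDiffOn_infty.2 fun n => ?_
  induction n generalizing ψ with
  | zero =>
    exact contDiffOn_zero.2 fun θ hθ =>
      (hasFDerivAt_functional_affineComp G hθ ψ).continuousAt.continuousWithinAt
  | succ n ih =>
    refine (contDiffOn_succ_iff_fderiv_of_isOpen (n := (n : ℕ∞ω)) isOpen_affineSet).2
      ⟨fun θ hθ => (hasFDerivAt_functional_affineComp G hθ ψ).differentiableAt
        |>.differentiableWithinAt, fun h => absurd h (by simp), ?_⟩
    refine ContDiffOn.congr ?_ fun θ hθ => (hasFDerivAt_functional_affineComp G hθ ψ).fderiv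
    exact ContDiffOn.sum fun κ _ =>
      ((contDiffOn_affineCoeff κ).of_le (by exact_mod_cast le_top)).smulRight (ih _)

/-! ## The shearlet representation in terms of affine maps -/

/-- The linear map of the plane with the matrix `[α, β; 0, γ]`. -/
def upperMap (α β γ : ℝ) : Plane →L[ℝ] Plane :=
  α • (EuclideanSpace.proj (𝕜 := ℝ) (0 : Fin 2) : Plane →L[ℝ] ℝ).smulRight
      (EuclideanSpace.single 0 (1 : ℝ))
  + β • (EuclideanSpace.proj (𝕜 := ℝ) (1 : Fin 2) : Plane →L[ℝ] ℝ).smulRight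
      (EuclideanSpace.single 0 (1 : ℝ))
  + γ • (EuclideanSpace.proj (𝕜 := ℝ) (1 : Fin 2) : Plane →L[ℝ] ℝ).smulRight
      (EuclideanSpace.single 1 (1 : ℝ))

theorem upperMap_apply_zero (α β γ : ℝ) (x : Plane) : upperMap α β γ x 0 = α * x 0 + β * x 1 := by
  simp [upperMap]

theorem upperMap_apply_one (α β γ : ℝ) (x : Plane) : upperMap α β γ x 1 = γ * x 1 := by
  simp [upperMap]

theorem norm_upperMap_le (α β γ : ℝ) : ‖upperMap α β γ‖ ≤ |α| + |β| + |γ| := by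
  have h : ∀ i j : Fin 2, ‖(EuclideanSpace.proj (𝕜 := ℝ) i : Plane →L[ℝ] ℝ).smulRight
      (EuclideanSpace.single j (1 : ℝ) : Plane)‖ ≤ 1 := by
    intro i j
    refine ContinuousLinearMap.opNorm_le_bound _ zero_le_one fun x => ?_
    rw [ContinuousLinearMap.smulRight_apply, norm_smul, PiLp.norm_single, norm_one,
      mul_one, one_mul]
    exact PiLp.norm_apply_le x i
  have h' : ∀ (c : ℝ) (i j : Fin 2), ‖c • (EuclideanSpace.proj (𝕜 := ℝ) i :
      Plane →L[ℝ] ℝ).smulRight (EuclideanSpace.single j (1 : ℝ) : Plane)‖ ≤ |c| := by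
    intro c i j
    rw [norm_smul, Real.norm_eq_abs]
    exact mul_le_of_le_one_right (abs_nonneg c) (h i j)
  exact (norm_add₃_le).trans (add_le_add_three (h' α 0 0) (h' β 1 0) (h' γ 1 1))

/-- The linear map `A_a⁻¹ N_s⁻¹`. -/
def shearletMap (q : Plane × ℝ × ℝ) : Plane →L[ℝ] Plane :=
  upperMap q.2.2⁻¹ (q.2.1 * q.2.2⁻¹) (q.2.2 * |q.2.2| ^ (-(1 / 2) : ℝ))⁻¹

/-- The linear map `N_s A_a`. -/
def shearletInvMap (q : Plane × ℝ × ℝ) : Plane →L[ℝ] Plane :=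
  upperMap q.2.2 (-(q.2.1 * (q.2.2 * |q.2.2| ^ (-(1 / 2) : ℝ))))
    (q.2.2 * |q.2.2| ^ (-(1 / 2) : ℝ))

/-- The parameters of the affine map `x ↦ A_a⁻¹ N_s⁻¹ (x - b)`. -/
def shearletParam (q : Plane × ℝ × ℝ) : AffineParam := (q.1, shearletMap q)

theorem rpow_abs_pos {q : Plane × ℝ × ℝ} (hq : q ∈ shearletSet) (t : ℝ) : 0 < |q.2.2| ^ t :=
  Real.rpow_pos_of_pos (abs_pos.2 hq) t

theorem shearletMap_comp_inv {q : Plane × ℝ × ℝ} (hq : q ∈ shearletSet) :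
    shearletMap q ∘L shearletInvMap q = ContinuousLinearMap.id ℝ Plane := by
  have h1 : q.2.2 ≠ 0 := hq
  have h2 := (rpow_abs_pos hq (-(1 / 2))).ne'
  ext x i
  fin_cases i
  · simp [shearletMap, shearletInvMap, upperMap_apply_zero, upperMap_apply_one]
    field_simp
    ring
  · simp [shearletMap, shearletInvMap, upperMap_apply_one]
    field_simp

theorem shearletInvMap_comp {q : Plane × ℝ × ℝ} (hq : q ∈ shearletSet) :
    shearletInvMap q ∘L shearletMap q = ContinuousLinearMap.id ℝ Plane := by
  have h1 : q.2.2 ≠ 0 := hq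
  have h2 := (rpow_abs_pos hq (-(1 / 2))).ne'
  ext x i
  fin_cases i
  · simp [shearletMap, shearletInvMap, upperMap_apply_zero, upperMap_apply_one]
    field_simp
    ring
  · simp [shearletMap, shearletInvMap, upperMap_apply_one]
    field_simp

theorem shearletParam_mem {q : Plane × ℝ × ℝ} (hq : q ∈ shearletSet) :
    shearletParam q ∈ affineSet :=
  ContinuousLinearMap.IsInvertible.of_inverse (shearletMap_comp_inv hq) (shearletInvMap_comp hq)

theorem inverse_shearletMap {q : Plane × ℝ × ℝ} (hq : q ∈ shearletSet) :
    (shearletMap q).inverse = shearletInvMap q :=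
  ContinuousLinearMap.inverse_eq (shearletMap_comp_inv hq) (shearletInvMap_comp hq)

theorem invMatrix_eq (p : ShearletGroup) : invMatrix p
    = !![p.a⁻¹, p.s * p.a⁻¹; 0, (p.a * |p.a| ^ (-(1 / 2) : ℝ))⁻¹] := by
  have h1 : p.a ≠ 0 := p.2
  have h2 : |p.a| ^ (-(1 / 2) : ℝ) ≠ 0 := (rpow_abs_pos p.2 (-(1 / 2))).ne'
  have e1 : (dilationMatrix p.a)⁻¹ = !![p.a⁻¹, 0; 0, (p.a * |p.a| ^ (-(1 / 2) : ℝ))⁻¹] := by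
    refine Matrix.inv_eq_right_inv ?_
    rw [dilationMatrix, Matrix.one_fin_two, Matrix.smul_of]
    generalize |p.a| ^ (-(1 / 2) : ℝ) = c at h2 ⊢
    ext i j
    fin_cases i <;> fin_cases j <;> simp [Matrix.mul_apply, h1]
    field_simp
  have e2 : (shearMatrix p.s)⁻¹ = !![1, p.s; 0, 1] := by
    refine Matrix.inv_eq_right_inv ?_
    rw [shearMatrix, Matrix.one_fin_two]
    ext i j
    fin_cases i <;> fin_cases j <;> simp [Matrix.mul_apply]
  rw [invMatrix, e1, e2]
  ext i j
  fin_cases i <;> fin_cases j <;> simp [Matrix.mul_apply, mul_comm]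

/-- The bridge from the matrix definition to the affine calculus. -/
theorem shearletRep_eq (p : ShearletGroup) (ψ : S0) : (shearletRep p ψ).1
    = (|p.a| ^ (-(3 / 4) : ℝ)) • affineComp (shearletParam p.1) ψ.1 := by
  ext x
  rw [shearletRep_apply, _root_.smul_apply, affineComp_apply (shearletParam_mem p.2),
    Complex.real_smul]
  congr 2
  have := invMatrix_eq p
  rw [invMatrix] at this
  rw [this]
  ext i
  fin_cases i
  · simp [shearletParam, shearletMap, upperMap_apply_zero, Matrix.mulVec, dotProduct,
      ShearletGroup.b, ShearletGroup.s, ShearletGroup.a]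
    ring
  · simp [shearletParam, shearletMap, upperMap_apply_one, Matrix.mulVec, dotProduct,
      ShearletGroup.b, ShearletGroup.a]
    ring

theorem contDiffOn_rpow_abs (t : ℝ) :
    ContDiffOn ℝ ∞ (fun q : Plane × ℝ × ℝ => |q.2.2| ^ t) shearletSet := by
  intro q hq
  have h : ContDiffAt ℝ ∞ (fun q : Plane × ℝ × ℝ => |q.2.2|) q :=
    (contDiffAt_abs hq).comp q (contDiff_snd.comp contDiff_snd).contDiffAt
  exact (h.rpow_const_of_ne (abs_pos.2 hq).ne').contDiffWithinAt

theorem contDiffOn_shearletParam : ContDiffOn ℝ ∞ shearletParam shearletSet := by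
  have ha : ContDiffOn ℝ ∞ (fun q : Plane × ℝ × ℝ => q.2.2) shearletSet :=
    (contDiff_snd.comp contDiff_snd).contDiffOn
  have hs : ContDiffOn ℝ ∞ (fun q : Plane × ℝ × ℝ => q.2.1) shearletSet :=
    (contDiff_fst.comp contDiff_snd).contDiffOn
  have hi := ha.inv fun q hq => hq
  have hr := (ha.mul (contDiffOn_rpow_abs (-(1 / 2)))).inv fun q hq =>
    mul_ne_zero hq (rpow_abs_pos hq (-(1 / 2))).ne'
  exact contDiff_fst.contDiffOn.prodMk (((hi.smul contDiffOn_const).add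
    ((hs.mul hi).smul contDiffOn_const)).add (hr.smul contDiffOn_const))

theorem continuous_shearletRep (ψ : S0) :
    Continuous fun p : ShearletGroup => (shearletRep p ψ).1 := by
  simp only [shearletRep_eq]
  have h1 : Continuous fun p : ShearletGroup => |p.a| ^ (-(3 / 4) : ℝ) :=
    (contDiffOn_rpow_abs (-(3 / 4))).continuousOn.domRestrict
  have h2 : Continuous fun p : ShearletGroup => shearletParam p.1 :=
    contDiffOn_shearletParam.continuousOn.domRestrict
  have h3 : Continuous fun p : ShearletGroup => affineComp (shearletParam p.1) ψ.1 :=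
    continuous_iff_continuousAt.2 fun p =>
      ContinuousAt.comp (f := fun p : ShearletGroup => shearletParam p.1)
        (continuousAt_affineComp (shearletParam_mem p.2) ψ.1) h2.continuousAt
  exact h1.smul h3

theorem conjS0_shearletRep (p : ShearletGroup) (ψ : S0) :
    conjS0 (shearletRep p ψ) = shearletRep p (conjS0 ψ) := by
  refine Subtype.ext (SchwartzMap.ext fun x => ?_)
  rw [conjS0_apply, shearletRep_apply, shearletRep_apply, conjS0_apply, map_mul,
    Complex.conj_ofReal]

theorem isSmooth_functional_shearletRep (G : 𝓢(Plane, ℂ) →L[ℝ] ℂ) (ψ : S0) :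
    IsSmooth fun p => G (shearletRep p ψ).1 := by
  refine ContDiffOn.congr (f := fun q : Plane × ℝ × ℝ => (|q.2.2| ^ (-(3 / 4) : ℝ)) •
    G (affineComp (shearletParam q) ψ.1)) ?_ fun q hq => ?_
  · exact (contDiffOn_rpow_abs _).smul ((contDiffOn_functional_affineComp G ψ.1).comp
      contDiffOn_shearletParam fun q hq => shearletParam_mem hq)
  · rw [extendZero, dif_pos hq, shearletRep_eq, map_smul]
    rfl

/-! ## Polynomial bounds on the shearlet group -/

/-- The size `(1 + |b|) (1 + |s|) (|a| + 1 / |a|)` of a point of the shearlet group. -/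
def size (p : ShearletGroup) : ℝ := (1 + ‖p.b‖) * (1 + |p.s|) * (|p.a| + |p.a|⁻¹)

theorem abs_a_pos (p : ShearletGroup) : 0 < |p.a| := abs_pos.2 p.2

theorem one_le_abs_add_inv (p : ShearletGroup) : 1 ≤ |p.a| + |p.a|⁻¹ := by
  have h := abs_a_pos p
  rcases le_total 1 |p.a| with h1 | h1
  · exact h1.trans (le_add_of_nonneg_right (by positivity))
  · exact ((one_le_inv₀ h).2 h1).trans (le_add_of_nonneg_left h.le)

theorem abs_add_inv_le_size (p : ShearletGroup) : |p.a| + |p.a|⁻¹ ≤ size p := by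
  have h := abs_a_pos p
  refine le_mul_of_one_le_left (by positivity) ?_
  nlinarith [norm_nonneg p.b, abs_nonneg p.s, mul_nonneg (norm_nonneg p.b) (abs_nonneg p.s)]

theorem one_add_norm_mul_le_size (p : ShearletGroup) : (1 + ‖p.b‖) * (1 + |p.s|) ≤ size p :=
  le_mul_of_one_le_right (by positivity) (one_le_abs_add_inv p)

theorem norm_b_le_size (p : ShearletGroup) : ‖p.b‖ ≤ size p := by
  refine le_trans ?_ (one_add_norm_mul_le_size p)
  nlinarith [norm_nonneg p.b, abs_nonneg p.s, mul_nonneg (norm_nonneg p.b) (abs_nonneg p.s)]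

theorem one_add_abs_s_mul_le_size (p : ShearletGroup) :
    (1 + |p.s|) * (|p.a| + |p.a|⁻¹) ≤ size p := by
  rw [size, mul_assoc]
  exact le_mul_of_one_le_left (by positivity) (le_add_of_nonneg_right (norm_nonneg _))

theorem one_le_size (p : ShearletGroup) : 1 ≤ size p :=
  (one_le_abs_add_inv p).trans (abs_add_inv_le_size p)

theorem size_pos (p : ShearletGroup) : 0 < size p := one_pos.trans_le (one_le_size p)

/-- Used for the fractional exponents `-3/4` and `±1/2` of the representation. -/
theorem rpow_abs_le (p : ShearletGroup) {t : ℝ} (h1 : -1 ≤ t) (h2 : t ≤ 1) :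
    |p.a| ^ t ≤ |p.a| + |p.a|⁻¹ := by
  have h := abs_a_pos p
  rcases le_total 1 |p.a| with ha | ha
  · refine ((Real.rpow_le_rpow_of_exponent_le ha h2).trans_eq (Real.rpow_one _)).trans ?_
    exact le_add_of_nonneg_right (by positivity)
  · refine ((Real.rpow_le_rpow_of_exponent_ge h ha h1).trans_eq (Real.rpow_neg_one _)).trans ?_
    exact le_add_of_nonneg_left h.le

theorem norm_shearletMap_le (p : ShearletGroup) : ‖shearletMap p.1‖ ≤ 3 * size p ^ 2 := by
  have h := abs_a_pos p
  have hc : (|p.a| ^ (-(1 / 2) : ℝ))⁻¹ ≤ |p.a| + |p.a|⁻¹ := by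
    rw [← Real.rpow_neg h.le]
    exact rpow_abs_le p (by norm_num) (by norm_num)
  have hA : |p.a|⁻¹ ≤ |p.a| + |p.a|⁻¹ := le_add_of_nonneg_left h.le
  have hc0 : 0 ≤ |p.a| ^ (-(1 / 2) : ℝ) := (rpow_abs_pos p.2 _).le
  have hz := one_le_size p
  have hz2 : size p ≤ size p ^ 2 := by nlinarith
  have b1 : |p.a⁻¹| ≤ size p ^ 2 := by
    rw [abs_inv]
    exact (hA.trans (abs_add_inv_le_size p)).trans hz2
  have b2 : |p.s * p.a⁻¹| ≤ size p ^ 2 := by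
    rw [abs_mul, abs_inv]
    refine le_trans ?_ ((one_add_abs_s_mul_le_size p).trans hz2)
    gcongr
    exact le_add_of_nonneg_left zero_le_one
  have b3 : |(p.a * |p.a| ^ (-(1 / 2) : ℝ))⁻¹| ≤ size p ^ 2 := by
    rw [abs_inv, abs_mul, abs_of_nonneg hc0, mul_inv, sq]
    exact mul_le_mul (hA.trans (abs_add_inv_le_size p)) (hc.trans (abs_add_inv_le_size p))
      (by positivity) (size_pos p).le
  refine (norm_upperMap_le _ _ _).trans ?_
  change |p.a⁻¹| + |p.s * p.a⁻¹| + |(p.a * |p.a| ^ (-(1 / 2) : ℝ))⁻¹| ≤ _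
  linarith

theorem norm_shearletInvMap_le (p : ShearletGroup) : ‖shearletInvMap p.1‖ ≤ 3 * size p ^ 2 := by
  have h := abs_a_pos p
  have hc : |p.a| ^ (-(1 / 2) : ℝ) ≤ |p.a| + |p.a|⁻¹ :=
    rpow_abs_le p (by norm_num) (by norm_num)
  have hA : |p.a| ≤ |p.a| + |p.a|⁻¹ := le_add_of_nonneg_right (by positivity)
  have hc0 : 0 ≤ |p.a| ^ (-(1 / 2) : ℝ) := (rpow_abs_pos p.2 _).le
  have hz := one_le_size p
  have hz2 : size p ≤ size p ^ 2 := by nlinarith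
  have b1 : |p.a| ≤ size p ^ 2 := (hA.trans (abs_add_inv_le_size p)).trans hz2
  have b2 : |-(p.s * (p.a * |p.a| ^ (-(1 / 2) : ℝ)))| ≤ size p ^ 2 := by
    rw [abs_neg, abs_mul, abs_mul, abs_of_nonneg hc0, ← mul_assoc, sq]
    refine mul_le_mul (le_trans ?_ (one_add_abs_s_mul_le_size p))
      (hc.trans (abs_add_inv_le_size p)) hc0 (size_pos p).le
    gcongr
    exact le_add_of_nonneg_left zero_le_one
  have b3 : |p.a * |p.a| ^ (-(1 / 2) : ℝ)| ≤ size p ^ 2 := by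
    rw [abs_mul, abs_of_nonneg hc0, sq]
    exact mul_le_mul (hA.trans (abs_add_inv_le_size p)) (hc.trans (abs_add_inv_le_size p)) hc0
      (size_pos p).le
  refine (norm_upperMap_le _ _ _).trans ?_
  change |p.a| + |-(p.s * (p.a * |p.a| ^ (-(1 / 2) : ℝ)))| + |p.a * |p.a| ^ (-(1 / 2) : ℝ)| ≤ _
  linarith

theorem exists_seminorm_shearletRep_le (ψ : S0) (k n : ℕ) : ∃ (C : ℝ) (N : ℕ), 0 ≤ C ∧
    ∀ p, SchwartzMap.seminorm ℝ k n (shearletRep p ψ).1 ≤ C * size p ^ N := by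
  set A := SchwartzMap.seminorm ℝ k n ψ.1
  set B := SchwartzMap.seminorm ℝ 0 n ψ.1
  have hA : 0 ≤ A := apply_nonneg _ _
  have hB : 0 ≤ B := apply_nonneg _ _
  -- The exponent collects one power for `|a| ^ (-3/4)`, two for each of the `n` factors `‖M‖`, and
  -- two for each of the `k` factors `‖M⁻¹‖` or `‖b‖`.
  refine ⟨3 ^ n * (2 ^ k * (3 ^ k * A + B)), 1 + 2 * n + 2 * k, by positivity, fun p => ?_⟩
  have hz := one_le_size p
  have hz0 := (size_pos p).le
  rw [shearletRep_eq, map_smul_eq_mul, Real.norm_of_nonneg (Real.rpow_nonneg (abs_nonneg _) _)]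
  have h1 : |p.a| ^ (-(3 / 4) : ℝ) ≤ size p :=
    (rpow_abs_le p (by norm_num) (by norm_num)).trans (abs_add_inv_le_size p)
  have h2 : affineBound k n ψ.1 (shearletParam p.1)
      ≤ (3 * size p ^ 2) ^ n * (2 ^ k * ((3 * size p ^ 2) ^ k * A + (size p ^ 2) ^ k * B)) := by
    unfold affineBound
    change ‖shearletMap p.1‖ ^ n * (2 ^ k * (‖(shearletMap p.1).inverse‖ ^ k * A
      + ‖p.b‖ ^ k * B)) ≤ _
    rw [inverse_shearletMap p.2]
    have := norm_shearletMap_le p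
    have := norm_shearletInvMap_le p
    have : ‖p.b‖ ≤ size p ^ 2 := (norm_b_le_size p).trans (by nlinarith)
    gcongr
  calc _ ≤ size p * ((3 * size p ^ 2) ^ n *
        (2 ^ k * ((3 * size p ^ 2) ^ k * A + (size p ^ 2) ^ k * B))) := by
        refine mul_le_mul h1 ((seminorm_affineComp_le (shearletParam_mem p.2) ψ.1 k n).trans h2)
          (apply_nonneg _ _) hz0
    _ = _ := by
      rw [mul_pow, mul_pow, pow_add, pow_add, pow_one, pow_mul, pow_mul]
      ring

theorem exists_functional_shearletRep_le (G : 𝓢(Plane, ℂ) →L[ℝ] ℂ) (ψ : S0) :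
    ∃ (C : ℝ) (N : ℕ), 0 ≤ C ∧ ∀ p, ‖G (shearletRep p ψ).1‖ ≤ C * size p ^ N := by
  obtain ⟨s, C, -, hC⟩ := Seminorm.bound_of_continuous (schwartz_withSeminorms ℝ Plane ℂ)
    ((normSeminorm ℝ ℂ).comp G.toLinearMap) G.continuous.norm
  choose D N hD hDN using fun i : ℕ × ℕ => exists_seminorm_shearletRep_le ψ i.1 i.2
  have hD0 : 0 ≤ ∑ i ∈ s, D i := Finset.sum_nonneg fun i _ => hD i
  refine ⟨C * ∑ i ∈ s, D i, ∑ i ∈ s, N i, mul_nonneg C.2 hD0, fun p => ?_⟩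
  have hz := size_pos p
  refine (hC _).trans ?_
  rw [mul_assoc]
  refine mul_le_mul_of_nonneg_left ?_ C.2
  refine Seminorm.finset_sup_apply_le (mul_nonneg hD0 (by positivity)) fun i hi => ?_
  refine (hDN i p).trans (mul_le_mul (Finset.single_le_sum (fun j _ => hD j) hi)
    (pow_le_pow_right₀ (one_le_size p) ?_) (by positivity) hD0)
  exact Finset.single_le_sum (f := N) (fun _ _ => Nat.zero_le _) hi

theorem one_add_norm_le_bracket {E : Type*} [NormedAddCommGroup E] (t : E) :
    1 + ‖t‖ ≤ 2 * bracket t := by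
  have h : 0 ≤ bracket t := Real.sqrt_nonneg _
  have h2 : bracket t ^ 2 = 1 + ‖t‖ ^ 2 := Real.sq_sqrt (by positivity)
  refine abs_le_of_sq_le_sq' ?_ (by positivity) |>.2
  nlinarith [sq_nonneg (1 - ‖t‖)]

theorem hasPolynomialGrowth_of_le_size {F : ShearletGroup → ℂ} {C : ℝ} {N : ℕ} (hC : 0 ≤ C)
    (h : ∀ p, ‖F p‖ ≤ C * size p ^ N) : HasPolynomialGrowth F := by
  -- Exponents and constant are raised by one to be strictly positive. The `8` is one factor `2` for
  -- each of `b`, `s` and `a`.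
  refine ⟨N + 1, N + 1, N + 1, (C + 1) * 8 ^ (N + 1), by positivity, by positivity, by positivity,
    by positivity, fun p => ?_⟩
  have ha := abs_a_pos p
  have hb0 : 0 ≤ bracket p.b := Real.sqrt_nonneg _
  have hs0 : 0 ≤ bracket p.s := Real.sqrt_nonneg _
  have e : ((N : ℝ) + 1) = ((N + 1 : ℕ) : ℝ) := by push_cast; rfl
  rw [e, Real.rpow_natCast, Real.rpow_natCast, Real.rpow_natCast]
  have h1 : size p ≤ 2 * bracket p.b * (2 * bracket p.s) * (|p.a| + |p.a|⁻¹) := by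
    unfold size
    have := one_add_norm_le_bracket p.b
    have := one_add_norm_le_bracket p.s
    rw [Real.norm_eq_abs] at this
    gcongr
  have h2 : (|p.a| + |p.a|⁻¹) ^ (N + 1) ≤ 2 ^ (N + 1) * (|p.a| ^ (N + 1) + 1 / |p.a| ^ (N + 1)) := by
    refine (add_pow_le ha.le (by positivity) _).trans ?_
    rw [inv_pow, one_div]
    gcongr
    · norm_num
    · omega
  calc ‖F p‖ ≤ C * size p ^ N := h p
    _ ≤ (C + 1) * size p ^ (N + 1) := by
      have := one_le_size p
      have := size_pos p
      gcongr
      · linarith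
      · omega
    _ ≤ (C + 1) * (2 * bracket p.b * (2 * bracket p.s) * (|p.a| + |p.a|⁻¹)) ^ (N + 1) := by
      have := size_pos p
      gcongr
    _ = (C + 1) * (2 ^ (N + 1) * bracket p.b ^ (N + 1) * (2 ^ (N + 1) * bracket p.s ^ (N + 1))
        * (|p.a| + |p.a|⁻¹) ^ (N + 1)) := by simp only [mul_pow]
    _ ≤ (C + 1) * (2 ^ (N + 1) * bracket p.b ^ (N + 1) * (2 ^ (N + 1) * bracket p.s ^ (N + 1))
        * (2 ^ (N + 1) * (|p.a| ^ (N + 1) + 1 / |p.a| ^ (N + 1)))) := by gcongr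
    _ = _ := by
      rw [show (8 : ℝ) = 2 * 2 * 2 by norm_num, mul_pow, mul_pow]
      ring

/-! ### Haar integrability and the decay of test functions -/

theorem continuous_size : Continuous size := by
  have hb : Continuous fun p : ShearletGroup => p.b := continuous_fst.comp continuous_subtype_val
  have hs : Continuous fun p : ShearletGroup => p.s :=
    (continuous_fst.comp continuous_snd).comp continuous_subtype_val
  have ha : Continuous fun p : ShearletGroup => p.a :=
    (continuous_snd.comp continuous_snd).comp continuous_subtype_val
  exact ((continuous_const.add hb.norm).mul (continuous_const.add hs.abs)).mul
    (ha.abs.add (ha.abs.inv₀ fun p => (abs_a_pos p).ne'))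

theorem measurable_a : Measurable fun p : ShearletGroup => p.a :=
  ((continuous_snd.comp continuous_snd).comp continuous_subtype_val).measurable

/-- Negative powers of the size are integrable with respect to the Haar measure. -/
theorem integrable_size_inv : Integrable (fun p => (size p ^ 5)⁻¹) haar := by
  have hm : Measurable fun p : ShearletGroup => ENNReal.ofReal ((|p.a| ^ 3)⁻¹) := by
    have := measurable_a
    exact ((this.abs.pow_const 3).inv).ennreal_ofReal
  rw [haar,
    integrable_withDensity_iff hm (Filter.Eventually.of_forall fun p => ENNReal.ofReal_lt_top)]
  have h1 : Integrable (fun b : Plane => (1 + ‖b‖) ^ (-(5 : ℝ))) volume :=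
    integrable_one_add_norm (by simp; norm_num)
  have h2 : Integrable (fun s : ℝ => (1 + ‖s‖) ^ (-(5 : ℝ))) volume :=
    integrable_one_add_norm (by simp)
  -- A product majorant. The exponent `5` exceeds the dimension of the plane and of the line, and
  -- leaves room for the density `|a| ^ (-3)`.
  have hI : Integrable (fun q : Plane × ℝ × ℝ => (1 + ‖q.1‖) ^ (-(5 : ℝ)) *
      ((1 + ‖q.2.1‖) ^ (-(5 : ℝ)) * (1 + q.2.2 ^ 2)⁻¹)) volume :=
    h1.mul_prod (h2.mul_prod integrable_inv_one_add_sq)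
  have hI' := (integrableOn_iff_comap_subtypeVal isOpen_shearletSet.measurableSet).1
    (hI.integrableOn (s := shearletSet))
  refine hI'.mono' ?_ (Filter.Eventually.of_forall fun p : ShearletGroup => ?_)
  · exact ((continuous_size.measurable.pow_const 5).inv.mul hm.ennreal_toReal).aestronglyMeasurable
  · have ha := abs_a_pos p
    have hz := size_pos p
    rw [ENNReal.toReal_ofReal (by positivity), Real.norm_of_nonneg (by positivity)]
    change _ ≤ (1 + ‖p.b‖) ^ (-(5 : ℝ)) * ((1 + |p.s|) ^ (-(5 : ℝ)) * (1 + p.a ^ 2)⁻¹)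
    rw [Real.rpow_neg (by positivity), Real.rpow_neg (by positivity)]
    norm_cast
    rw [← mul_inv, ← mul_inv, ← mul_inv]
    -- With `t = |a|` the right side is `(1 + t²) ^ 5 / t²`, so the claim reduces to `t² ≤ (1 + t²)
    -- ^ 4`.
    have key : 1 + p.a ^ 2 ≤ (|p.a| + |p.a|⁻¹) ^ 5 * |p.a| ^ 3 := by
      rw [← sq_abs p.a]
      have e : |p.a| + |p.a|⁻¹ = (1 + |p.a| ^ 2) / |p.a| := by field_simp; ring
      rw [e, div_pow, div_mul_eq_mul_div, le_div_iff₀ (by positivity)]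
      set t := |p.a|
      have h4 : t ^ 2 ≤ (1 + t ^ 2) ^ 4 := by
        have := one_le_pow₀ (by nlinarith [sq_nonneg t] : 1 ≤ 1 + t ^ 2) (n := 3)
        calc t ^ 2 ≤ (1 + t ^ 2) * 1 := by linarith
          _ ≤ (1 + t ^ 2) * (1 + t ^ 2) ^ 3 := by gcongr
          _ = _ := by ring
      calc (1 + t ^ 2) * t ^ 5 = (1 + t ^ 2) * t ^ 2 * t ^ 3 := by ring
        _ ≤ (1 + t ^ 2) * (1 + t ^ 2) ^ 4 * t ^ 3 := by gcongr
        _ = _ := by ring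
    refine inv_anti₀ (by positivity) ?_
    calc (1 + ‖p.b‖) ^ 5 * ((1 + |p.s|) ^ 5 * (1 + p.a ^ 2))
        ≤ (1 + ‖p.b‖) ^ 5 * ((1 + |p.s|) ^ 5 * ((|p.a| + |p.a|⁻¹) ^ 5 * |p.a| ^ 3)) := by gcongr
      _ = _ := by unfold size; ring

theorem continuous_testSpace (Φ : TestSpace) : Continuous (Φ : ShearletGroup → ℂ) := by
  have h : ContinuousOn (extendZero Φ) shearletSet := ContDiffOn.continuousOn Φ.2.1
  refine h.domRestrict.congr fun p => ?_
  simp [extendZero]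

/-- The index of the norm `sup ⟨b₁⟩^N ⟨b₂⟩^N ⟨s⟩^N (|a|^N + 1 / |a|^N) |Φ|`. -/
def decayIndex (N : ℕ) : NormIndex := ⟨N, N, N, N, 0, 0, 0, 0⟩

/-- The weights in `b₁` and `b₂` control the norm of `b` because `1 + b₁² + b₂² ≤ (1 + b₁²)(1 +
b₂²)`. -/
theorem size_pow_le_weight (N : ℕ) (p : ShearletGroup) :
    size p ^ N ≤ 8 ^ N * weight (decayIndex N) p := by
  have ha := abs_a_pos p
  have h1 : 1 + ‖p.b‖ ≤ 2 * (bracket (p.b 0) * bracket (p.b 1)) := by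
    refine (one_add_norm_le_bracket p.b).trans (mul_le_mul_of_nonneg_left ?_ zero_le_two)
    unfold bracket
    rw [← Real.sqrt_mul (by positivity), EuclideanSpace.norm_sq_eq, Fin.sum_univ_two]
    refine Real.sqrt_le_sqrt ?_
    nlinarith [mul_nonneg (sq_nonneg ‖p.b 0‖) (sq_nonneg ‖p.b 1‖)]
  have h2 : 1 + |p.s| ≤ 2 * bracket p.s := one_add_norm_le_bracket p.s
  have h3 : (|p.a| + |p.a|⁻¹) ^ N ≤ 2 ^ N * (|p.a| ^ N + 1 / |p.a| ^ N) := by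
    refine (add_pow_le ha.le (by positivity) _).trans ?_
    rw [inv_pow, one_div]
    gcongr
    · norm_num
    · omega
  have hb0 : 0 ≤ bracket (p.b 0) := Real.sqrt_nonneg _
  have hb1 : 0 ≤ bracket (p.b 1) := Real.sqrt_nonneg _
  have hs : 0 ≤ bracket p.s := Real.sqrt_nonneg _
  calc size p ^ N = (1 + ‖p.b‖) ^ N * (1 + |p.s|) ^ N * (|p.a| + |p.a|⁻¹) ^ N := by
        rw [size, mul_pow, mul_pow]
    _ ≤ (2 * (bracket (p.b 0) * bracket (p.b 1))) ^ N * (2 * bracket p.s) ^ N *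
        (2 ^ N * (|p.a| ^ N + 1 / |p.a| ^ N)) := by gcongr
    _ = _ := by
      rw [show (8 : ℝ) = 2 * 2 * 2 by norm_num]
      simp only [weight, decayIndex, mul_pow]
      ring

theorem norm_testSpace_le (N : ℕ) (Φ : TestSpace) (p : ShearletGroup) :
    ‖Φ p‖ * size p ^ N ≤ 8 ^ N * testNorm (decayIndex N) Φ := by
  have e : normIntegrand (decayIndex N) Φ p = weight (decayIndex N) p * ‖Φ p‖ := by
    simp [normIntegrand, mixedPartial, decayIndex, extendZero]
  have h : weight (decayIndex N) p * ‖Φ p‖ ≤ testNorm (decayIndex N) Φ :=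
    e ▸ le_ciSup (Φ.2.2 (decayIndex N)) p
  calc ‖Φ p‖ * size p ^ N ≤ ‖Φ p‖ * (8 ^ N * weight (decayIndex N) p) :=
        mul_le_mul_of_nonneg_left (size_pow_le_weight N p) (norm_nonneg _)
    _ = 8 ^ N * (weight (decayIndex N) p * ‖Φ p‖) := by ring
    _ ≤ _ := by gcongr

/-- Five powers of decay beyond the growth `N` are spent on the integrable factor `size ^ (-5)`. -/
theorem mul_norm_testSpace_le {x C : ℝ} {N : ℕ} (Φ : TestSpace) (p : ShearletGroup) (hC : 0 ≤ C)
    (hx : x ≤ C * size p ^ N) :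
    x * ‖Φ p‖ ≤ C * 8 ^ (N + 5) * testNorm (decayIndex (N + 5)) Φ * (size p ^ 5)⁻¹ := by
  have hz := size_pos p
  rw [← div_eq_mul_inv, le_div_iff₀ (by positivity)]
  calc x * ‖Φ p‖ * size p ^ 5 ≤ C * size p ^ N * ‖Φ p‖ * size p ^ 5 := by gcongr
    _ = C * (‖Φ p‖ * size p ^ (N + 5)) := by ring
    _ ≤ C * (8 ^ (N + 5) * testNorm (decayIndex (N + 5)) Φ) :=
      mul_le_mul_of_nonneg_left (norm_testSpace_le _ _ _) hC
    _ = _ := by ring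

/-! ## The synthesis operator -/

theorem continuous_smul_shearletRep (ψ : S0) (Φ : TestSpace) :
    Continuous fun p : ShearletGroup => Φ p • (shearletRep p ψ).1 :=
  (continuous_testSpace Φ).smul (continuous_shearletRep ψ)

theorem isDominated_synthesis (ψ : S0) (Φ : TestSpace) :
    IsDominated haar fun p => Φ p • (shearletRep p ψ).1 := by
  refine ⟨fun n x => ?_, fun k n => ?_⟩
  · simp only [← derivAt_apply]
    exact ((derivAt n x).continuous.comp (continuous_smul_shearletRep ψ Φ)).aestronglyMeasurable
  · obtain ⟨C, N, hC, h⟩ := exists_seminorm_shearletRep_le ψ k n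
    refine ⟨fun p => C * 8 ^ (N + 5) * testNorm (decayIndex (N + 5)) Φ * (size p ^ 5)⁻¹,
      integrable_size_inv.const_mul _, Filter.Eventually.of_forall fun p => ?_⟩
    have e : SchwartzMap.seminorm ℝ k n (Φ p • (shearletRep p ψ).1)
        = ‖Φ p‖ * SchwartzMap.seminorm ℝ k n (shearletRep p ψ).1 :=
      map_smul_eq_mul (SchwartzMap.seminorm ℂ k n) (Φ p) (shearletRep p ψ).1
    rw [e, mul_comm]
    exact mul_norm_testSpace_le Φ p hC (h p)

theorem functional_synthesis (ψ : S0) (Φ : TestSpace) (G : 𝓢(Plane, ℂ) →L[ℂ] ℂ) :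
    Integrable (fun p => G (shearletRep p ψ).1 * Φ p) haar ∧
    G (isDominated_synthesis ψ Φ).integral = ∫ p, G (shearletRep p ψ).1 * Φ p ∂haar := by
  have h := (isDominated_synthesis ψ Φ).functional (continuous_smul_shearletRep ψ Φ)
    (G.restrictScalars ℝ)
  simpa only [ContinuousLinearMap.coe_restrictScalars', map_smul, smul_eq_mul,
    mul_comm (Φ _)] using h

/-- Each moment is a continuous functional on the Schwartz space, so it passes under the integral,
where it vanishes on every `π_p ψ`. -/
theorem integral_synthesis_mem (ψ : S0) (Φ : TestSpace) :
    (isDominated_synthesis ψ Φ).integral ∈ lizorkin 2 := by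
  intro m
  let G : 𝓢(Plane, ℂ) →L[ℂ] ℂ := SchwartzMap.integralCLM ℂ volume ∘L
    SchwartzMap.smulLeftCLM ℂ (fun x : Plane => ((∏ i, x i ^ m i : ℝ) : ℂ))
  have hG : ∀ φ, G φ = ∫ x : Plane, ((∏ i, x i ^ m i : ℝ) : ℂ) * φ x := fun φ => by
    simp only [G, ContinuousLinearMap.comp_apply, SchwartzMap.integralCLM_apply,
      SchwartzMap.smulLeftCLM_apply_apply (hasTemperateGrowth_monomial m), smul_eq_mul]
  have h := (functional_synthesis ψ Φ G).2
  have hz : ∀ p, G (shearletRep p ψ).1 = 0 := fun p => (hG _).trans ((shearletRep p ψ).2 m)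
  simp only [hz, zero_mul, integral_zero] at h
  exact (hG _).symm.trans h

/-- A function of polynomial growth on the shearlet group as an element of `𝒮'(𝕊)`. -/
theorem exists_dual_of_integrable {F : ShearletGroup → ℂ} {C : ℝ} {N : ℕ} (hC : 0 ≤ C)
    (hF : ∀ p, ‖F p‖ ≤ C * size p ^ N)
    (hI : ∀ Φ : TestSpace, Integrable (fun p => F p * Φ p) haar) :
    ∃ T : TestSpaceDual, ∀ Φ : TestSpace, T Φ = ∫ p, F p * Φ p ∂haar := by
  let L : TestSpace →ₗ[ℂ] ℂ :=
    { toFun := fun Φ => ∫ p, F p * Φ p ∂haar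
      map_add' := fun Φ Ψ => by
        rw [← integral_add (hI Φ) (hI Ψ)]
        refine integral_congr_ae (Filter.Eventually.of_forall fun p => ?_)
        exact mul_add (F p) (Φ p) (Ψ p)
      map_smul' := fun c Φ => by
        rw [RingHom.id_apply, smul_eq_mul, ← integral_const_mul]
        refine integral_congr_ae (Filter.Eventually.of_forall fun p => ?_)
        exact mul_left_comm (F p) c (Φ p) }
  have hK : 0 ≤ ∫ p, (size p ^ 5)⁻¹ ∂haar :=
    integral_nonneg fun p => inv_nonneg.2 (pow_nonneg (size_pos p).le 5)
  let K : NNReal := ⟨C * 8 ^ (N + 5) * ∫ p, (size p ^ 5)⁻¹ ∂haar, by positivity⟩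
  refine ⟨⟨L, testSpace_withSeminorms.continuous_normedSpace_rng ℂ L
    ⟨{decayIndex (N + 5)}, K, fun Φ => ?_⟩⟩, fun Φ => rfl⟩
  rw [Finset.sup_singleton]
  change ‖∫ p, F p * Φ p ∂haar‖ ≤ (C * 8 ^ (N + 5) * ∫ p, (size p ^ 5)⁻¹ ∂haar) *
    testNorm (decayIndex (N + 5)) Φ
  refine (norm_integral_le_of_norm_le (integrable_size_inv.const_mul
    (C * 8 ^ (N + 5) * testNorm (decayIndex (N + 5)) Φ))
    (Filter.Eventually.of_forall fun p => ?_)).trans_eq ?_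
  · rw [norm_mul]
    exact mul_norm_testSpace_le Φ p hC (hF p)
  · rw [integral_const_mul]
    ring

/-- Hahn–Banach for the subspace topology. It allows all estimates and integrals to be carried out
in the full Schwartz space. -/
theorem exists_extension (f : S0Dual) : ∃ G : 𝓢(Plane, ℂ) →L[ℂ] ℂ, ∀ φ : S0, G φ.1 = f φ := by
  have : PolynormableSpace ℂ 𝓢(Plane, ℂ) :=
    (schwartz_withSeminorms ℂ Plane ℂ).toPolynormableSpace
  exact StrongDual.exists_extension (lizorkin 2) f

end Shearlet

end

/-! ### The theorem -/

theorem mainTheorem4 (ψ : Shearlet.S0) (f : Shearlet.S0Dual) :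
    Shearlet.IsSmooth (Shearlet.shearletFunction ψ f) ∧
    Shearlet.HasPolynomialGrowth (Shearlet.shearletFunction ψ f) ∧
    ∃ T : Shearlet.TestSpaceDual,
      Shearlet.IsShearletTransform ψ f T ∧
      Shearlet.IsGivenBy T (Shearlet.shearletFunction ψ f) := by
  open Shearlet in
  obtain ⟨G, hG⟩ := exists_extension f
  have e : shearletFunction ψ f = fun p => G (shearletRep p (conjS0 ψ)).1 := by
    funext p
    rw [shearletFunction, conjS0_shearletRep, hG]
  obtain ⟨C, N, hC, hCN⟩ := exists_functional_shearletRep_le (G.restrictScalars ℝ) (conjS0 ψ)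
  have hI := fun Φ => functional_synthesis (conjS0 ψ) Φ G
  obtain ⟨T, hT⟩ := exists_dual_of_integrable hC hCN fun Φ => (hI Φ).1
  rw [e]
  refine ⟨isSmooth_functional_shearletRep (G.restrictScalars ℝ) (conjS0 ψ),
    hasPolynomialGrowth_of_le_size hC hCN, T, fun Φ => ⟨fun x => ?_,
      ⟨(isDominated_synthesis (conjS0 ψ) Φ).integral, integral_synthesis_mem (conjS0 ψ) Φ⟩,
      fun x => rfl, ?_⟩, fun Φ => ⟨(hI Φ).1, hT Φ⟩⟩
  · exact (isDominated_synthesis (conjS0 ψ) Φ).integrable_apply x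
  -- The synthesis lies in `𝒮₀`, so `f` may be replaced by `G`, which passes under the integral.
  · rw [← hG]
    exact (hT Φ).trans (hI Φ).2.symm
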